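/- All operads are operads in the category of sets and have no units. A \emph{cyclic operad} $\mathcal C$ is a functor from finite sets and bijections to sets with compositions ${}_a\circ_b:\mathcal C(R\sqcup\{a\})\times\mathcal C(S\sqcup\{b\})\to\mathcal C(R\sqcup S)$ that are equivariant, symmetric ($x\,{}_a\circ_b\,y=y\,{}_b\circ_a\,x$) and associative. A \emph{modular operad} $\mathcal M$ has in addition a genus grading (with values in a commutative monoid $\mathbb S$ containing $\mathbb N$, e.g. $\mathbb N$ or $\frac12\mathbb N$), additive under compositions, and contractions $\circ_{uv}=\circ_{vu}:\mathcal M(S\sqcup\{u,v\})\to\mathcal M(S)$ that raise the genus by $1$, are equivariant, commute with each other, and satisfy $\circ_{cd}(x\,{}_a\circ_b\,y)=\circ_{ab}(x\,{}_c\circ_d\,y)$ for inputs $a,c$ of $x$ and $b,d$ of $y$, and $\circ_{uv}(x\,{}_a\circ_b\,y)=(\circ_{uv}x)\,{}_a\circ_b\,y$ for inputs $a,u,v$ of $x$. The \emph{modular completion} $\mathrm{Mod}$ is the left adjoint of the functor $\square$ from modular to cyclic operads that keeps only the elements of genus $0$. \textbf{Proposition.} Let $\mathcal C$ be a cyclic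 operad. Every element $x\in\mathrm{Mod}(\mathcal C)(S)$, $S$ a finite set, is of the form $$x=\circ_{p'_1p''_1}\cdots\circ_{p'_np''_n}(y),\qquad (*)$$ where $n\ge 0$, $p'_1,p''_1,\dots,p'_n,p''_n$ are distinct labels not in $S$, and $y\in\mathcal C(S\sqcup\{p'_1,p''_1,\dots,p'_n,p''_n\})$ (identified with its image in $\mathrm{Mod}(\mathcal C)$). In such expressions the pairs $\{p'_i,p''_i\}$ are regarded as unordered. Consider the following moves between expressions of the form $(*)$ with the same $S$. (i) For $w'\in\mathcal C(\{p',q'\}\sqcup R)$ and $w''\in\mathcal C(\{p'',q''\}\sqcup T)$, replace $$\circ_{p'_1p''_1}\cdots\circ_{p'_{n-1}p''_{n-1}}\circ_{p'p''}(w'\,{}_{q'}\circ_{q''}\,w'')\quad\text{by}\quad\circ_{p'_1p''_1}\cdots\circ_{p'_{n-1}p''_{n-1}}\circ_{q'q''}(w'\,{}_{p'}\circ_{p''}\,w'').$$ (ii) For inputs $p',p''$ of $y$, distinct labels $q',q''$ different from all the remaining inputs of $y$, and the bijection $\rho$ that maps $p',p''$ to $q',q''$ in this order and fixes the remaining inputs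 of $y$, replace $$\circ_{p'_1p''_1}\cdots\circ_{p'_{n-1}p''_{n-1}}\circ_{p'p''}(y)\quad\text{by}\quad\circ_{p'_1p''_1}\cdots\circ_{p'_{n-1}p''_{n-1}}\circ_{q'q''}(\rho y).$$ (iii) For a permutation $\sigma\in\Sigma_n$, replace $$\circ_{p'_1p''_1}\cdots\circ_{p'_np''_n}(y)\quad\text{by}\quad\circ_{p'_{\sigma(1)}p''_{\sigma(1)}}\cdots\circ_{p'_{\sigma(n)}p''_{\sigma(n)}}(y).$$ Two expressions $(*)$ represent the same element of $\mathrm{Mod}(\mathcal C)(S)$ if and only if they are related by a finite number of these moves. -/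

import Mathlib

universe u v w s

/-! Finite sets are finite subsets of an infinite set `α` of labels.  All operads are operads in
the category of sets, indexed by finite sets and their bijections, without units. -/

/-- `X = S ⊔ {a}`, `Y = T ⊔ {b}` and `Z = S ⊔ T`, for disjoint finite sets `X` and `Y`: the
situation in which `∘_{ab} : P(X) × P(Y) → P(Z)` is defined. -/
structure IsGluing {α : Type u} [DecidableEq α] (a b : α) (X Y Z : Finset α) : Prop where
  mem_left : a ∈ X
  mem_right : b ∈ Y
  disjoint : Disjoint X Y
  eq : Z = X.erase a ∪ Y.erase b

/-- `X = Z ⊔ e` for an unordered pair `e = {u, v}` of distinct labels: the situation in which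
the contraction `∘_{uv} : P(X) → P(Z)` is defined. -/
structure IsContraction {α : Type u} [DecidableEq α] (e : Sym2 α) (X Z : Finset α) : Prop where
  not_isDiag : ¬ e.IsDiag
  disjoint : Disjoint e.toFinset Z
  eq : X = e.toFinset ∪ Z

/-- Two bijections of finite sets have the same values on the common part of their domains. -/
def Agree {α : Type u} {X X' Z Z' : Finset α} (σ : X ≃ X') (τ : Z ≃ Z') : Prop :=
  ∀ (i : X) (j : Z), (i : α) = j → (σ i : α) = τ j

/-- A cyclic operad in sets. -/
structure CyclicOperad (α : Type u) [DecidableEq α] where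
  /-- the set of operations with the given finite set of inputs -/
  obj : Finset α → Type v
  /-- relabelling of the inputs along a bijection -/
  map : ∀ {X Y : Finset α}, (X ≃ Y) → obj X → obj Y
  /-- the composition `x ∘_{ab} y` -/
  comp : ∀ {a b : α} {X Y Z : Finset α}, IsGluing a b X Y Z → obj X → obj Y → obj Z
  map_refl : ∀ {X : Finset α} (x : obj X), map (Equiv.refl X) x = x
  map_trans : ∀ {X Y Z : Finset α} (σ : X ≃ Y) (τ : Y ≃ Z) (x : obj X),
    map (σ.trans τ) x = map τ (map σ x)
  comp_map : ∀ {a b a' b' : α} {X Y Z X' Y' Z' : Finset α}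
    (h : IsGluing a b X Y Z) (h' : IsGluing a' b' X' Y' Z')
    (σ : X ≃ X') (τ : Y ≃ Y') (ω : Z ≃ Z'),
    (σ ⟨a, h.mem_left⟩ : α) = a' → (τ ⟨b, h.mem_right⟩ : α) = b' → Agree σ ω → Agree τ ω →
    ∀ (x : obj X) (y : obj Y), comp h' (map σ x) (map τ y) = map ω (comp h x y)
  comp_comm : ∀ {a b : α} {X Y Z : Finset α} (h : IsGluing a b X Y Z) (h' : IsGluing b a Y X Z)
    (x : obj X) (y : obj Y), comp h x y = comp h' y x
  comp_assoc : ∀ {a b c d : α} {X Y Z XY YZ W : Finset α}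
    (h₁ : IsGluing a b X Y XY) (h₂ : IsGluing c d XY Z W)
    (h₃ : IsGluing c d Y Z YZ) (h₄ : IsGluing a b X YZ W)
    (x : obj X) (y : obj Y) (z : obj Z), comp h₂ (comp h₁ x y) z = comp h₄ x (comp h₃ y z)

/-- A modular operad in sets whose operadic genus takes values in `𝕊`.  The component of genus
`G` with inputs `X` is the set of all `x : obj X` with `genus x = G`. -/
structure ModularOperad (α : Type u) [DecidableEq α] (𝕊 : Type s) [AddCommMonoidWithOne 𝕊]
    extends CyclicOperad.{u, v} α where
  genus : ∀ {X : Finset α}, obj X → 𝕊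
  /-- the contraction `∘_{uv}` along the unordered pair `{u, v}` -/
  contr : ∀ {e : Sym2 α} {X Z : Finset α}, IsContraction e X Z → obj X → obj Z
  genus_map : ∀ {X Y : Finset α} (σ : X ≃ Y) (x : obj X), genus (map σ x) = genus x
  genus_comp : ∀ {a b : α} {X Y Z : Finset α} (h : IsGluing a b X Y Z) (x : obj X) (y : obj Y),
    genus (comp h x y) = genus x + genus y
  genus_contr : ∀ {e : Sym2 α} {X Z : Finset α} (h : IsContraction e X Z) (x : obj X),
    genus (contr h x) = genus x + 1
  contr_map : ∀ {e e' : Sym2 α} {X Z X' Z' : Finset α}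
    (h : IsContraction e X Z) (h' : IsContraction e' X' Z') (σ : X ≃ X') (τ : Z ≃ Z'),
    (∀ i : X, (i : α) ∈ e → (σ i : α) ∈ e') → Agree σ τ →
    ∀ x : obj X, contr h' (map σ x) = map τ (contr h x)
  contr_contr : ∀ {e f : Sym2 α} {X Y Y' Z : Finset α}
    (h₁ : IsContraction e X Y) (h₂ : IsContraction f Y Z)
    (h₃ : IsContraction f X Y') (h₄ : IsContraction e Y' Z)
    (x : obj X), contr h₂ (contr h₁ x) = contr h₄ (contr h₃ x)
  /-- `∘_{cd} (x ∘_{ab} y) = ∘_{ab} (x ∘_{cd} y)` if `a, c` are inputs of `x` and `b, d` are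
  inputs of `y` -/
  contr_comp_exchange : ∀ {a b c d : α} {X Y Z Z' W : Finset α}
    (h₁ : IsGluing a b X Y Z) (k₁ : IsContraction s(c, d) Z W)
    (h₂ : IsGluing c d X Y Z') (k₂ : IsContraction s(a, b) Z' W)
    (x : obj X) (y : obj Y), contr k₁ (comp h₁ x y) = contr k₂ (comp h₂ x y)
  /-- `∘_{uv} (x ∘_{ab} y) = (∘_{uv} x) ∘_{ab} y` if `a, u, v` are inputs of `x` -/
  contr_comp : ∀ {a b : α} {e : Sym2 α} {X X' Y Z W : Finset α}
    (h₁ : IsGluing a b X Y Z) (k₁ : IsContraction e Z W)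
    (k₂ : IsContraction e X X') (h₂ : IsGluing a b X' Y W)
    (x : obj X) (y : obj Y), contr k₁ (comp h₁ x y) = comp h₂ (contr k₂ x) y

/-- A morphism of cyclic operads. -/
@[ext] structure CyclicOperad.Hom {α : Type u} [DecidableEq α]
    (C : CyclicOperad.{u, v} α) (D : CyclicOperad.{u, w} α) where
  app : ∀ {X : Finset α}, C.obj X → D.obj X
  app_map : ∀ {X Y : Finset α} (σ : X ≃ Y) (x : C.obj X), app (C.map σ x) = D.map σ (app x)
  app_comp : ∀ {a b : α} {X Y Z : Finset α} (h : IsGluing a b X Y Z) (x : C.obj X) (y : C.obj Y),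
    app (C.comp h x y) = D.comp h (app x) (app y)

/-- A morphism of modular operads. -/
@[ext] structure ModularOperad.Hom {α : Type u} [DecidableEq α] {𝕊 : Type s}
    [AddCommMonoidWithOne 𝕊] (M : ModularOperad.{u, v} α 𝕊) (N : ModularOperad.{u, w} α 𝕊)
    extends CyclicOperad.Hom M.toCyclicOperad N.toCyclicOperad where
  app_genus : ∀ {X : Finset α} (x : M.obj X), N.genus (app x) = M.genus x
  app_contr : ∀ {e : Sym2 α} {X Z : Finset α} (h : IsContraction e X Z) (x : M.obj X),
    app (M.contr h x) = N.contr h (app x)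

/-- The forgetful functor `□` from modular operads to cyclic operads, on objects: the cyclic
operad of all elements of genus `0`. -/
def ModularOperad.genusZero {α : Type u} [DecidableEq α] {𝕊 : Type s} [AddCommMonoidWithOne 𝕊]
    (M : ModularOperad.{u, v} α 𝕊) : CyclicOperad.{u, v} α where
  obj X := {x : M.obj X // M.genus x = 0}
  map σ x := ⟨M.map σ x.1, by rw [M.genus_map, x.2]⟩
  comp h x y := ⟨M.comp h x.1 y.1, by rw [M.genus_comp, x.2, y.2, add_zero]⟩
  map_refl x := Subtype.ext (M.map_refl x.1)
  map_trans σ τ x := Subtype.ext (M.map_trans σ τ x.1)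
  comp_map h h' σ τ ω ha hb hσ hτ x y :=
    Subtype.ext (M.comp_map h h' σ τ ω ha hb hσ hτ x.1 y.1)
  comp_comm h h' x y := Subtype.ext (M.comp_comm h h' x.1 y.1)
  comp_assoc h₁ h₂ h₃ h₄ x y z := Subtype.ext (M.comp_assoc h₁ h₂ h₃ h₄ x.1 y.1 z.1)

/-- The forgetful functor `□` on morphisms. -/
def ModularOperad.Hom.genusZero {α : Type u} [DecidableEq α] {𝕊 : Type s}
    [AddCommMonoidWithOne 𝕊] {M : ModularOperad.{u, v} α 𝕊} {N : ModularOperad.{u, w} α 𝕊}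
    (ψ : ModularOperad.Hom M N) : CyclicOperad.Hom M.genusZero N.genusZero where
  app x := ⟨ψ.app x.1, by rw [ψ.app_genus, x.2]⟩
  app_map σ x := Subtype.ext (ψ.app_map σ x.1)
  app_comp h x y := Subtype.ext (ψ.app_comp h x.1 y.1)

/-- Composition of morphisms of cyclic operads. -/
def CyclicOperad.Hom.andThen {α : Type u} [DecidableEq α] {B : CyclicOperad.{u, v} α}
    {C : CyclicOperad.{u, w} α} {D : CyclicOperad.{u, s} α}
    (φ : CyclicOperad.Hom B C) (ψ : CyclicOperad.Hom C D) : CyclicOperad.Hom B D where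
  app x := ψ.app (φ.app x)
  app_map σ x := by rw [φ.app_map, ψ.app_map]
  app_comp h x y := by rw [φ.app_comp, ψ.app_comp]

/-! ### The modular completion: the left adjoint of `□`

It is the modular operad generated by the elements of `C`, in which the relabellings and
compositions of `C` are identified with the formal ones. -/

namespace CyclicOperad

/-- Formal modular operad expressions in the elements of `C`. -/
inductive Term {α : Type u} [DecidableEq α] (C : CyclicOperad.{u, v} α) :
    Finset α → Type (max u v)
  | gen {X : Finset α} (x : C.obj X) : Term C X
  | map {X Y : Finset α} (σ : X ≃ Y) (x : Term C X) : Term C Y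
  | comp {a b : α} {X Y Z : Finset α} (h : IsGluing a b X Y Z) (x : Term C X) (y : Term C Y) :
      Term C Z
  | contr {e : Sym2 α} {X Z : Finset α} (h : IsContraction e X Z) (x : Term C X) : Term C Z

/-- The congruence on formal expressions generated by the axioms of a modular operad and the
structure operations of `C`. -/
inductive Term.Rel {α : Type u} [DecidableEq α] (C : CyclicOperad.{u, v} α) :
    ∀ {X : Finset α}, Term C X → Term C X → Prop
  | refl {X : Finset α} (x : Term C X) : Rel C x x
  | symm {X : Finset α} {x y : Term C X} : Rel C x y → Rel C y x
  | trans {X : Finset α} {x y z : Term C X} : Rel C x y → Rel C y z → Rel C x z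
  | congr_map {X Y : Finset α} (σ : X ≃ Y) {x x' : Term C X} :
      Rel C x x' → Rel C (.map σ x) (.map σ x')
  | congr_comp {a b : α} {X Y Z : Finset α} (h : IsGluing a b X Y Z) {x x' : Term C X}
      {y y' : Term C Y} : Rel C x x' → Rel C y y' → Rel C (.comp h x y) (.comp h x' y')
  | congr_contr {e : Sym2 α} {X Z : Finset α} (h : IsContraction e X Z) {x x' : Term C X} :
      Rel C x x' → Rel C (.contr h x) (.contr h x')
  | gen_map {X Y : Finset α} (σ : X ≃ Y) (x : C.obj X) :
      Rel C (.gen (C.map σ x)) (.map σ (.gen x))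
  | gen_comp {a b : α} {X Y Z : Finset α} (h : IsGluing a b X Y Z) (x : C.obj X) (y : C.obj Y) :
      Rel C (.gen (C.comp h x y)) (.comp h (.gen x) (.gen y))
  | map_refl {X : Finset α} (x : Term C X) : Rel C (.map (Equiv.refl X) x) x
  | map_trans {X Y Z : Finset α} (σ : X ≃ Y) (τ : Y ≃ Z) (x : Term C X) :
      Rel C (.map (σ.trans τ) x) (.map τ (.map σ x))
  | comp_map {a b a' b' : α} {X Y Z X' Y' Z' : Finset α}
      (h : IsGluing a b X Y Z) (h' : IsGluing a' b' X' Y' Z')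
      (σ : X ≃ X') (τ : Y ≃ Y') (ω : Z ≃ Z')
      (ha : (σ ⟨a, h.mem_left⟩ : α) = a') (hb : (τ ⟨b, h.mem_right⟩ : α) = b')
      (hσ : Agree σ ω) (hτ : Agree τ ω) (x : Term C X) (y : Term C Y) :
      Rel C (.comp h' (.map σ x) (.map τ y)) (.map ω (.comp h x y))
  | comp_comm {a b : α} {X Y Z : Finset α} (h : IsGluing a b X Y Z) (h' : IsGluing b a Y X Z)
      (x : Term C X) (y : Term C Y) : Rel C (.comp h x y) (.comp h' y x)
  | comp_assoc {a b c d : α} {X Y Z XY YZ W : Finset α}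
      (h₁ : IsGluing a b X Y XY) (h₂ : IsGluing c d XY Z W)
      (h₃ : IsGluing c d Y Z YZ) (h₄ : IsGluing a b X YZ W)
      (x : Term C X) (y : Term C Y) (z : Term C Z) :
      Rel C (.comp h₂ (.comp h₁ x y) z) (.comp h₄ x (.comp h₃ y z))
  | contr_map {e e' : Sym2 α} {X Z X' Z' : Finset α}
      (h : IsContraction e X Z) (h' : IsContraction e' X' Z') (σ : X ≃ X') (τ : Z ≃ Z')
      (he : ∀ i : X, (i : α) ∈ e → (σ i : α) ∈ e') (hσ : Agree σ τ) (x : Term C X) :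
      Rel C (.contr h' (.map σ x)) (.map τ (.contr h x))
  | contr_contr {e f : Sym2 α} {X Y Y' Z : Finset α}
      (h₁ : IsContraction e X Y) (h₂ : IsContraction f Y Z)
      (h₃ : IsContraction f X Y') (h₄ : IsContraction e Y' Z) (x : Term C X) :
      Rel C (.contr h₂ (.contr h₁ x)) (.contr h₄ (.contr h₃ x))
  | contr_comp_exchange {a b c d : α} {X Y Z Z' W : Finset α}
      (h₁ : IsGluing a b X Y Z) (k₁ : IsContraction s(c, d) Z W)
      (h₂ : IsGluing c d X Y Z') (k₂ : IsContraction s(a, b) Z' W)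
      (x : Term C X) (y : Term C Y) :
      Rel C (.contr k₁ (.comp h₁ x y)) (.contr k₂ (.comp h₂ x y))
  | contr_comp {a b : α} {e : Sym2 α} {X X' Y Z W : Finset α}
      (h₁ : IsGluing a b X Y Z) (k₁ : IsContraction e Z W)
      (k₂ : IsContraction e X X') (h₂ : IsGluing a b X' Y W) (x : Term C X) (y : Term C Y) :
      Rel C (.contr k₁ (.comp h₁ x y)) (.comp h₂ (.contr k₂ x) y)

/-- The genus of a formal expression: the number of its contractions. -/
def Term.genus {α : Type u} [DecidableEq α] {C : CyclicOperad.{u, v} α} (𝕊 : Type s)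
    [AddCommMonoidWithOne 𝕊] : ∀ {X : Finset α}, Term C X → 𝕊
  | _, .gen _ => 0
  | _, .map _ x => x.genus 𝕊
  | _, .comp _ x y => x.genus 𝕊 + y.genus 𝕊
  | _, .contr _ x => x.genus 𝕊 + 1

theorem Term.Rel.genus_eq {α : Type u} [DecidableEq α] {C : CyclicOperad.{u, v} α} (𝕊 : Type s)
    [AddCommMonoidWithOne 𝕊] {X : Finset α} {x y : Term C X} (h : Term.Rel C x y) :
    x.genus 𝕊 = y.genus 𝕊 := by
  induction h <;> simp_all [Term.genus, add_assoc, add_comm]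

/-- Formal expressions up to the congruence `Term.Rel`. -/
def Term.setoid {α : Type u} [DecidableEq α] (C : CyclicOperad.{u, v} α) (X : Finset α) :
    Setoid (Term C X) :=
  ⟨Term.Rel C, ⟨.refl, .symm, .trans⟩⟩

/-- The modular completion `Mod(C)` of a cyclic operad `C`. -/
def Mod {α : Type u} [DecidableEq α] (C : CyclicOperad.{u, v} α) (𝕊 : Type s)
    [AddCommMonoidWithOne 𝕊] : ModularOperad.{u, max u v} α 𝕊 where
  obj X := Quotient (Term.setoid C X)
  map σ := Quotient.map (Term.map σ) fun _ _ h => .congr_map σ h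
  comp h := Quotient.map₂ (Term.comp h) fun _ _ h₁ _ _ h₂ => .congr_comp h h₁ h₂
  genus := Quotient.lift (Term.genus 𝕊) fun _ _ h => h.genus_eq 𝕊
  contr h := Quotient.map (Term.contr h) fun _ _ h' => .congr_contr h h'
  map_refl x := Quotient.inductionOn x fun _ => Quotient.sound (.map_refl _)
  map_trans σ τ x := Quotient.inductionOn x fun _ => Quotient.sound (.map_trans σ τ _)
  comp_map h h' σ τ ω ha hb hσ hτ x y := Quotient.inductionOn₂ x y fun _ _ =>
    Quotient.sound (.comp_map h h' σ τ ω ha hb hσ hτ _ _)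
  comp_comm h h' x y := Quotient.inductionOn₂ x y fun _ _ => Quotient.sound (.comp_comm h h' _ _)
  comp_assoc h₁ h₂ h₃ h₄ x y z := Quotient.inductionOn₃ x y z fun _ _ _ =>
    Quotient.sound (.comp_assoc h₁ h₂ h₃ h₄ _ _ _)
  genus_map _ x := Quotient.inductionOn x fun _ => rfl
  genus_comp _ x y := Quotient.inductionOn₂ x y fun _ _ => rfl
  genus_contr _ x := Quotient.inductionOn x fun _ => rfl
  contr_map h h' σ τ he hσ x := Quotient.inductionOn x fun _ =>
    Quotient.sound (.contr_map h h' σ τ he hσ _)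
  contr_contr h₁ h₂ h₃ h₄ x := Quotient.inductionOn x fun _ =>
    Quotient.sound (.contr_contr h₁ h₂ h₃ h₄ _)
  contr_comp_exchange h₁ k₁ h₂ k₂ x y := Quotient.inductionOn₂ x y fun _ _ =>
    Quotient.sound (.contr_comp_exchange h₁ k₁ h₂ k₂ _ _)
  contr_comp h₁ k₁ k₂ h₂ x y := Quotient.inductionOn₂ x y fun _ _ =>
    Quotient.sound (.contr_comp h₁ k₁ k₂ h₂ _ _)

/-- The canonical morphism `C → □ Mod(C)`. -/
def toMod {α : Type u} [DecidableEq α] (C : CyclicOperad.{u, v} α) (𝕊 : Type s)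
    [AddCommMonoidWithOne 𝕊] : CyclicOperad.Hom C (C.Mod 𝕊).genusZero where
  app x := ⟨Quotient.mk (Term.setoid C _) (.gen x), rfl⟩
  app_map σ x := Subtype.ext (Quotient.sound (.gen_map σ x))
  app_comp h x y := Subtype.ext (Quotient.sound (.gen_comp h x y))

/-- The value of a formal expression in a modular operad under `C`. -/
def Term.eval {α : Type u} [DecidableEq α] {C : CyclicOperad.{u, v} α} {𝕊 : Type s}
    [AddCommMonoidWithOne 𝕊] {N : ModularOperad.{u, w} α 𝕊}
    (φ : CyclicOperad.Hom C N.genusZero) : ∀ {X : Finset α}, Term C X → N.obj X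
  | _, .gen x => (φ.app x).1
  | _, .map σ x => N.map σ (x.eval φ)
  | _, .comp h x y => N.comp h (x.eval φ) (y.eval φ)
  | _, .contr h x => N.contr h (x.eval φ)

theorem Term.genus_eval {α : Type u} [DecidableEq α] {C : CyclicOperad.{u, v} α} {𝕊 : Type s}
    [AddCommMonoidWithOne 𝕊] {N : ModularOperad.{u, w} α 𝕊}
    (φ : CyclicOperad.Hom C N.genusZero) {X : Finset α} (x : Term C X) :
    N.genus (x.eval φ) = x.genus 𝕊 := by
  induction x with
  | gen x => exact (φ.app x).2
  | map σ x ih => simp [Term.eval, Term.genus, N.genus_map, ih]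
  | comp h x y ih₁ ih₂ => simp [Term.eval, Term.genus, N.genus_comp, ih₁, ih₂]
  | contr h x ih => simp [Term.eval, Term.genus, N.genus_contr, ih]

theorem Term.Rel.eval_eq {α : Type u} [DecidableEq α] {C : CyclicOperad.{u, v} α} {𝕊 : Type s}
    [AddCommMonoidWithOne 𝕊] {N : ModularOperad.{u, w} α 𝕊}
    (φ : CyclicOperad.Hom C N.genusZero) {X : Finset α} {x y : Term C X} (h : Term.Rel C x y) :
    x.eval φ = y.eval φ := by
  induction h with
  | refl => rfl
  | symm _ ih => exact ih.symm
  | trans _ _ ih₁ ih₂ => exact ih₁.trans ih₂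
  | congr_map σ _ ih => simp only [Term.eval, ih]
  | congr_comp h _ _ ih₁ ih₂ => simp only [Term.eval, ih₁, ih₂]
  | congr_contr h _ ih => simp only [Term.eval, ih]
  | gen_map σ x => exact congrArg Subtype.val (φ.app_map σ x)
  | gen_comp h x y => exact congrArg Subtype.val (φ.app_comp h x y)
  | map_refl x => exact N.map_refl _
  | map_trans σ τ x => exact N.map_trans σ τ _
  | comp_map h h' σ τ ω ha hb hσ hτ x y => exact N.comp_map h h' σ τ ω ha hb hσ hτ _ _
  | comp_comm h h' x y => exact N.comp_comm h h' _ _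
  | comp_assoc h₁ h₂ h₃ h₄ x y z => exact N.comp_assoc h₁ h₂ h₃ h₄ _ _ _
  | contr_map h h' σ τ he hσ x => exact N.contr_map h h' σ τ he hσ _
  | contr_contr h₁ h₂ h₃ h₄ x => exact N.contr_contr h₁ h₂ h₃ h₄ _
  | contr_comp_exchange h₁ k₁ h₂ k₂ x y => exact N.contr_comp_exchange h₁ k₁ h₂ k₂ _ _
  | contr_comp h₁ k₁ k₂ h₂ x y => exact N.contr_comp h₁ k₁ k₂ h₂ _ _

/-- The morphism of modular operads `Mod(C) → N` induced by a morphism `C → □ N`. -/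
def liftMod {α : Type u} [DecidableEq α] {C : CyclicOperad.{u, v} α} {𝕊 : Type s}
    [AddCommMonoidWithOne 𝕊] {N : ModularOperad.{u, w} α 𝕊}
    (φ : CyclicOperad.Hom C N.genusZero) : ModularOperad.Hom (C.Mod 𝕊) N where
  app := Quotient.lift (Term.eval φ) fun _ _ h => h.eval_eq φ
  app_map _ x := Quotient.inductionOn x fun _ => rfl
  app_comp _ x y := Quotient.inductionOn₂ x y fun _ _ => rfl
  app_genus x := Quotient.inductionOn x fun t => t.genus_eval φ
  app_contr _ x := Quotient.inductionOn x fun _ => rfl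

/-- `Mod` is left adjoint to `□`: every morphism `C → □ N` of cyclic operads factors through
`C → □ Mod(C)` by a unique morphism of modular operads `Mod(C) → N`. -/
theorem existsUnique_liftMod {α : Type u} [DecidableEq α] {C : CyclicOperad.{u, v} α}
    {𝕊 : Type s} [AddCommMonoidWithOne 𝕊] {N : ModularOperad.{u, w} α 𝕊}
    (φ : CyclicOperad.Hom C N.genusZero) :
    ∃! ψ : ModularOperad.Hom (C.Mod 𝕊) N, (C.toMod 𝕊).andThen ψ.genusZero = φ := by
  refine ⟨liftMod φ, rfl, fun ψ hψ => ?_⟩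
  have key : ∀ (X : Finset α) (t : Term C X),
      ψ.app (Quotient.mk (Term.setoid C X) t) = t.eval φ := by
    intro X t
    induction t with
    | gen x => subst hψ; rfl
    | map σ x ih => exact (ψ.app_map σ (Quotient.mk _ x)).trans (congrArg _ ih)
    | comp h x y ih₁ ih₂ =>
      exact (ψ.app_comp h (Quotient.mk _ x) (Quotient.mk _ y)).trans (congrArg₂ _ ih₁ ih₂)
    | contr h x ih => exact (ψ.app_contr h (Quotient.mk _ x)).trans (congrArg _ ih)
  apply ModularOperad.Hom.ext
  funext X x
  exact Quotient.inductionOn x fun t => key X t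

end CyclicOperad

/-! ### Iterated contractions of elements of `C` -/

/-- `Contracts [e₁, …, eₙ] X S`: the `eᵢ` are pairwise disjoint pairs of distinct labels and
`X = S ⊔ e₁ ⊔ ⋯ ⊔ eₙ`, so that the contraction along `eₙ`, …, `e₁` leads from `X` to `S`. -/
def Contracts {α : Type u} [DecidableEq α] : List (Sym2 α) → Finset α → Finset α → Prop
  | [], X, S => X = S
  | e :: l, X, S => IsContraction e (e.toFinset ∪ S) S ∧ Contracts l X (e.toFinset ∪ S)

/-- The iterated contraction `∘_{e₁} ⋯ ∘_{eₙ} (y)`. -/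
def ModularOperad.iterContr {α : Type u} [DecidableEq α] {𝕊 : Type s} [AddCommMonoidWithOne 𝕊]
    (M : ModularOperad.{u, v} α 𝕊) {X : Finset α} (y : M.obj X) :
    ∀ (l : List (Sym2 α)) {S : Finset α}, Contracts l X S → M.obj S
  | [], _, h => h ▸ y
  | _ :: l, _, h => M.contr h.1 (M.iterContr y l h.2)

namespace CyclicOperad

/-- Expressions `∘_{p'₁p''₁} ⋯ ∘_{p'ₙp''ₙ} (y)` with `y ∈ C`, whose set of remaining inputs
is `S`. -/
structure Expr {α : Type u} [DecidableEq α] (C : CyclicOperad.{u, v} α) (S : Finset α) where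
  inputs : Finset α
  elt : C.obj inputs
  pairs : List (Sym2 α)
  contracts : Contracts pairs inputs S

/-- The element of `Mod(C)` represented by an expression. -/
def Expr.value {α : Type u} [DecidableEq α] {C : CyclicOperad.{u, v} α} {S : Finset α}
    (E : Expr C S) (𝕊 : Type s) [AddCommMonoidWithOne 𝕊] : (C.Mod 𝕊).obj S :=
  (C.Mod 𝕊).iterContr ((C.toMod 𝕊).app E.elt).1 E.pairs E.contracts

/-- The moves between expressions. -/
inductive Move {α : Type u} [DecidableEq α] {C : CyclicOperad.{u, v} α} {S : Finset α} :
    Expr C S → Expr C S → Prop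
  /-- move (i): `⋯ ∘_{p'p''} (w' ∘_{q'q''} w'')` is replaced by
  `⋯ ∘_{q'q''} (w' ∘_{p'p''} w'')` -/
  | exchange {p' q' p'' q'' : α} {X Y U V : Finset α} (w' : C.obj X) (w'' : C.obj Y)
      (l : List (Sym2 α)) (hq : IsGluing q' q'' X Y U) (hp : IsGluing p' p'' X Y V)
      (hU : Contracts (l ++ [s(p', p'')]) U S) (hV : Contracts (l ++ [s(q', q'')]) V S) :
      Move ⟨U, C.comp hq w' w'', l ++ [s(p', p'')], hU⟩
        ⟨V, C.comp hp w' w'', l ++ [s(q', q'')], hV⟩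
  /-- move (ii): `⋯ ∘_{p'p''} (y)` is replaced by `⋯ ∘_{q'q''} (ρ y)` -/
  | relabel {p' p'' q' q'' : α} {X X' : Finset α} (y : C.obj X) (l : List (Sym2 α))
      (ρ : X ≃ X') (hp' : ∀ i : X, (i : α) = p' → (ρ i : α) = q')
      (hp'' : ∀ i : X, (i : α) = p'' → (ρ i : α) = q'')
      (hρ : ∀ i : X, (i : α) ≠ p' → (i : α) ≠ p'' → (ρ i : α) = i)
      (hX : Contracts (l ++ [s(p', p'')]) X S) (hX' : Contracts (l ++ [s(q', q'')]) X' S) :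
      Move ⟨X, y, l ++ [s(p', p'')], hX⟩ ⟨X', C.map ρ y, l ++ [s(q', q'')], hX'⟩
  /-- move (iii): the contractions are permuted -/
  | permute {X : Finset α} (y : C.obj X) {l l' : List (Sym2 α)} (hl : l.Perm l')
      (h : Contracts l X S) (h' : Contracts l' X S) :
      Move ⟨X, y, l, h⟩ ⟨X, y, l', h'⟩

end CyclicOperad

/-! ### Labels -/

/-! Moves do not change the value. Move (i) is the exchange axiom for contractions of a composite,
(ii) is equivariance of contractions, (iii) is their commutation (`Move.value_eq`). Every element
has the form (*) because the values of expressions contain `C` and are closed under relabelling,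
composition and contraction. For composition, the contracted labels are first renamed apart, and the
contractions are then pulled out of both factors (`comp_iterContr`, `exists_expr_value_eq`).

For the converse, the expressions modulo moves are themselves made into a modular operad
`moveOperad`. It receives a morphism from `C`, which by the universal property extends to `liftMod
(C.toMoveOperad 𝕊)` on `Mod C`. That extension sends the value of an expression to its class
(`liftMod_value`), so equal values force equal classes. Since the moves are symmetric, equal classes
are joined by a chain of moves (`Expr.cls_eq_cls`).

The work lies in the composition of classes. Expressions can be glued only if their labels are
disjoint, so contracted labels must be renamed, and moves (ii) and (iii) must generate all renamings
(`Expr.cls_relabel_of_fixed`). Gluing must also respect moves (`Move.cls_glue_eq`); the essential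
case is move (i), where associativity turns the glued expression into one to which (i) applies again
(`Expr.cls_glue_exchange`). The mixed axioms then hold almost by design: exchange is move (i), while
commutation of contractions and contraction of one factor are instances of (iii). -/

theorem isGluing_iff {α : Type u} [DecidableEq α] {a b : α} {X Y Z : Finset α} :
    IsGluing a b X Y Z ↔ a ∈ X ∧ b ∈ Y ∧ (∀ x ∈ X, x ∉ Y) ∧
      ∀ z, z ∈ Z ↔ (z ≠ a ∧ z ∈ X) ∨ (z ≠ b ∧ z ∈ Y) := by
  constructor
  · rintro ⟨h₁, h₂, h₃, rfl⟩
    exact ⟨h₁, h₂, fun x hx => Finset.disjoint_left.1 h₃ hx, by simp⟩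
  · rintro ⟨h₁, h₂, h₃, h₄⟩
    exact ⟨h₁, h₂, Finset.disjoint_left.2 fun x => h₃ x, by ext; simp [h₄]⟩

theorem isContraction_iff {α : Type u} [DecidableEq α] {e : Sym2 α} {X Z : Finset α} :
    IsContraction e X Z ↔ ¬ e.IsDiag ∧ (∀ x ∈ e, x ∉ Z) ∧ ∀ x, x ∈ X ↔ x ∈ e ∨ x ∈ Z := by
  constructor
  · rintro ⟨h₁, h₂, rfl⟩
    exact ⟨h₁, fun x hx => Finset.disjoint_left.1 h₂ (Sym2.mem_toFinset.2 hx), by simp⟩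
  · rintro ⟨h₁, h₂, h₃⟩
    exact ⟨h₁, Finset.disjoint_left.2 fun x hx => h₂ x (Sym2.mem_toFinset.1 hx), by ext; simp [h₃]⟩

/-- A description that is symmetric in the pairs and does not mention the intermediate sets, hence
insensitive to reordering and suited to elementwise reasoning. -/
theorem contracts_iff {α : Type u} [DecidableEq α] {l : List (Sym2 α)} {X S : Finset α} :
    Contracts l X S ↔ (∀ e ∈ l, ¬ e.IsDiag) ∧ l.Pairwise (fun e f => ∀ x ∈ e, x ∉ f) ∧
      (∀ e ∈ l, ∀ x ∈ e, x ∉ S) ∧ ∀ x, x ∈ X ↔ x ∈ S ∨ ∃ e ∈ l, x ∈ e := by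
  induction l generalizing S with
  | nil => simp [Contracts, Finset.ext_iff]
  | cons e l ih =>
    simp only [Contracts, ih, isContraction_iff, Finset.mem_union, Sym2.mem_toFinset,
      List.mem_cons, List.pairwise_cons]
    grind

theorem Contracts.subset {α : Type u} [DecidableEq α] {l : List (Sym2 α)} {X S : Finset α}
    (h : Contracts l X S) : S ⊆ X := fun x hx => ((contracts_iff.1 h).2.2.2 x).2 (.inl hx)

theorem Contracts.cons {α : Type u} [DecidableEq α] {e : Sym2 α}
    {l : List (Sym2 α)} {X S Z : Finset α} (h : IsContraction e S Z) (hl : Contracts l X S) :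
    Contracts (e :: l) X Z :=
  ⟨h.eq ▸ h, h.eq ▸ hl⟩

theorem Contracts.perm {α : Type u} [DecidableEq α] {l l' : List (Sym2 α)} {X S : Finset α}
    (h : Contracts l X S) (hl : l.Perm l') : Contracts l' X S := by
  rw [contracts_iff] at h ⊢
  refine ⟨fun e he => h.1 e (hl.mem_iff.2 he), ?_, fun e he => h.2.2.1 e (hl.mem_iff.2 he), ?_⟩
  · exact (hl.pairwise_iff fun {e f} hef x hx hx' => hef x hx' hx).1 h.2.1
  · simpa [hl.mem_iff] using h.2.2.2

theorem Contracts.eq {α : Type u} [DecidableEq α] {l : List (Sym2 α)} {X X' S : Finset α}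
    (h : Contracts l X S) (h' : Contracts l X' S) : X = X' := by
  rw [contracts_iff] at h h'
  ext x
  rw [h.2.2.2, h'.2.2.2]

theorem Contracts.glue {α : Type u} [DecidableEq α] {a b : α} {l l' : List (Sym2 α)}
    {X Y S T R U : Finset α} (hX : Contracts l X S) (hY : Contracts l' Y T)
    (h : IsGluing a b S T R) (h' : IsGluing a b X Y U) : Contracts (l' ++ l) U R := by
  rw [contracts_iff] at *
  rw [isGluing_iff] at *
  simp only [List.mem_append, List.pairwise_append]
  grind

theorem IsGluing.of_contracts {α : Type u} [DecidableEq α] {a b : α} {l l' : List (Sym2 α)}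
    {X Y S T R : Finset α} (h : IsGluing a b S T R) (hX : Contracts l X S)
    (hY : Contracts l' Y T) (hd : Disjoint X Y) :
    IsGluing a b X Y (X.erase a ∪ Y.erase b) :=
  ⟨hX.subset h.mem_left, hY.subset h.mem_right, hd, rfl⟩

theorem IsGluing.symm {α : Type u} [DecidableEq α] {a b : α} {X Y Z : Finset α}
    (h : IsGluing a b X Y Z) : IsGluing b a Y X Z :=
  ⟨h.mem_right, h.mem_left, h.disjoint.symm, by rw [h.eq, Finset.union_comm]⟩

theorem Contracts.map_perm {α : Type u} [DecidableEq α] {l : List (Sym2 α)}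
    {X S X' S' : Finset α} (π : Equiv.Perm α) (h : Contracts l X S)
    (hX : ∀ x, x ∈ X ↔ π x ∈ X') (hS : ∀ x, x ∈ S ↔ π x ∈ S') :
    Contracts (l.map (Sym2.map π)) X' S' := by
  rw [contracts_iff] at *
  obtain ⟨h₁, h₂, h₃, h₄⟩ := h
  refine ⟨?_, ?_, ?_, ?_⟩
  · simpa [Sym2.isDiag_map π.injective] using h₁
  · rw [List.pairwise_map]
    refine h₂.imp fun {e f} hef x => ?_
    simp only [Sym2.mem_map]
    rintro ⟨y, hy, rfl⟩ ⟨z, hz, hzy⟩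
    exact hef y hy (π.injective hzy ▸ hz)
  · simp only [List.mem_map]
    rintro _ ⟨e, he, rfl⟩ x hx
    obtain ⟨y, hy, rfl⟩ := Sym2.mem_map.1 hx
    exact fun hS' => h₃ e he y hy ((hS y).2 hS')
  · intro x
    obtain ⟨x, rfl⟩ := π.surjective x
    simp [← hX, ← hS, h₄, Sym2.mem_map]

theorem IsGluing.map_perm {α : Type u} [DecidableEq α] {a b : α} {X Y Z X' Y' Z' : Finset α}
    (π : Equiv.Perm α) (h : IsGluing a b X Y Z) (hX : ∀ x, x ∈ X ↔ π x ∈ X')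
    (hY : ∀ x, x ∈ Y ↔ π x ∈ Y') (hZ : ∀ x, x ∈ Z ↔ π x ∈ Z') :
    IsGluing (π a) (π b) X' Y' Z' := by
  rw [isGluing_iff] at *
  refine ⟨(hX a).1 h.1, (hY b).1 h.2.1, fun x => ?_, fun x => ?_⟩
  · obtain ⟨x, rfl⟩ := π.surjective x
    rw [← hX, ← hY]
    exact h.2.2.1 x
  · obtain ⟨x, rfl⟩ := π.surjective x
    simp [← hX, ← hY, ← hZ, h.2.2.2]

/-- An injective map on a finite set of labels extends to a permutation of all labels. -/
theorem exists_perm_eqOn {α : Type u} {A : Finset α} {f : α → α} (hf : Set.InjOn f A) :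
    ∃ π : Equiv.Perm α, ∀ x ∈ A, π x = f x := by
  -- The inclusion of `A` and the restriction of `f` are two injective families of the same length;
  -- the symmetric group is transitive on such families.
  let g : Fin A.card ↪ α := A.equivFin.symm.toEmbedding.trans (Function.Embedding.subtype _)
  let g' : Fin A.card ↪ α := ⟨fun i => f (g i), fun i j hij =>
    g.injective (hf (A.equivFin.symm i).2 (A.equivFin.symm j).2 hij)⟩
  obtain ⟨π, hπ⟩ := (Equiv.Perm.isMultiplyPretransitive α A.card).exists_smul_eq g g'
  refine ⟨π, fun x hx => ?_⟩
  have := DFunLike.congr_fun hπ (A.equivFin ⟨x, hx⟩)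
  simpa [g, g'] using this

/-- There is a permutation of the labels that fixes `S` and moves all other labels from `A` out
of `F`. -/
theorem exists_perm_avoid {α : Type u} [DecidableEq α] [Infinite α] (A S F : Finset α) :
    ∃ π : Equiv.Perm α, (∀ x ∈ S, π x = x) ∧ ∀ x ∈ A, x ∉ S → π x ∉ F := by
  -- The cardinality is chosen so that `D \ (S ∪ F)` has exactly one fresh label for each element of
  -- `A \ S`.
  obtain ⟨D, hD, hDc⟩ := Infinite.exists_superset_card_eq (α := α) (S ∪ F)
    ((S ∪ F).card + (A \ S).card) (by omega)
  let φ : (A \ S : Finset α) ≃ (D \ (S ∪ F) : Finset α) := Finset.equivOfCardEq (by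
    rw [Finset.card_sdiff_of_subset hD, hDc]; omega)
  have hφ : ∀ x, (φ x : α) ∉ S ∧ (φ x : α) ∉ F := fun x => by
    have := (φ x).2
    simp only [Finset.mem_sdiff, Finset.mem_union, not_or] at this
    exact this.2
  obtain ⟨π, hπ⟩ := exists_perm_eqOn (A := S ∪ A)
    (f := fun x => if h : x ∈ A \ S then (φ ⟨x, h⟩ : α) else x) (by
      intro x hx y hy hxy
      by_cases h₁ : x ∈ A \ S <;> by_cases h₂ : y ∈ A \ S <;>
        simp only [h₁, h₂, dite_true, dite_false] at hxy
      · simpa using φ.injective (Subtype.ext hxy)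
      · have := hφ ⟨x, h₁⟩
        simp at hy h₂
        grind
      · have := hφ ⟨y, h₂⟩
        simp at hx h₁
        grind
      · exact hxy)
  refine ⟨π, fun x hx => ?_, fun x hx hxS => ?_⟩
  · rw [hπ x (by simp [hx]), dif_neg (by simp [hx])]
  · rw [hπ x (by simp [hx]), dif_pos (by simp [hx, hxS])]
    exact (hφ _).2

namespace CyclicOperad

/-! ### Relabelling of expressions along permutations of the labels -/

theorem map_congr {α : Type u} [DecidableEq α] (C : CyclicOperad.{u, v} α) {X Y : Finset α}
    {σ τ : X ≃ Y} (h : ∀ i, (σ i : α) = τ i) (x : C.obj X) : C.map σ x = C.map τ x := by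
  rw [show σ = τ from Equiv.ext fun i => Subtype.ext (h i)]

theorem map_id {α : Type u} [DecidableEq α] (C : CyclicOperad.{u, v} α) {X : Finset α}
    {σ : X ≃ X} (h : ∀ i, (σ i : α) = i) (x : C.obj X) : C.map σ x = x := by
  rw [C.map_congr (τ := Equiv.refl X) h, C.map_refl]

/-- Input sets are often equal only propositionally. A bijection that is the identity on labels
plays the role of the cast, which avoids heterogeneous equality. -/
theorem Expr.mk_eq_mk {α : Type u} [DecidableEq α] {C : CyclicOperad.{u, v} α}
    {S X X' : Finset α} {y : C.obj X} {y' : C.obj X'} {l l' : List (Sym2 α)}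
    {h : Contracts l X S} {h' : Contracts l' X' S} (σ : X ≃ X') (hσ : ∀ i, (σ i : α) = i)
    (hy : C.map σ y = y') (hl : l = l') : (⟨X, y, l, h⟩ : Expr C S) = ⟨X', y', l', h'⟩ := by
  obtain rfl : X = X' := by
    ext x
    exact ⟨fun hx => (hσ ⟨x, hx⟩).subst (motive := (· ∈ X')) (σ ⟨x, hx⟩).2, fun hx => by
      have := hσ (σ.symm ⟨x, hx⟩)
      rw [Equiv.apply_symm_apply] at this
      rw [show x = _ from this]
      exact (σ.symm ⟨x, hx⟩).2⟩
  rw [C.map_id hσ] at hy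
  subst hy hl
  rfl

/-- The relabelling of an expression along a permutation of all labels. -/
def Expr.relabel {α : Type u} [DecidableEq α] {C : CyclicOperad.{u, v} α} {S T : Finset α}
    (E : Expr C S) (π : Equiv.Perm α) (h : ∀ x, x ∈ S ↔ π x ∈ T) : Expr C T where
  inputs := E.inputs.map π.toEmbedding
  elt := C.map (π.subtypeEquiv (by simp)) E.elt
  pairs := E.pairs.map (Sym2.map π)
  contracts := E.contracts.map_perm π (by simp) h

theorem Expr.mem_inputs_relabel {α : Type u} [DecidableEq α] {C : CyclicOperad.{u, v} α}
    {S T : Finset α} (E : Expr C S) (π : Equiv.Perm α) (h : ∀ x, x ∈ S ↔ π x ∈ T) (x : α) :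
    x ∈ (E.relabel π h).inputs ↔ π.symm x ∈ E.inputs := by
  simp [relabel]

theorem Expr.mem_inputs_of_mem_pairs {α : Type u} [DecidableEq α] {C : CyclicOperad.{u, v} α}
    {S : Finset α} (E : Expr C S) {e : Sym2 α} (he : e ∈ E.pairs) {x : α} (hx : x ∈ e) :
    x ∈ E.inputs :=
  ((contracts_iff.1 E.contracts).2.2.2 x).2 (.inr ⟨e, he, hx⟩)

/-- All contracted labels are among the inputs, so the values of a permutation elsewhere are
irrelevant. -/
theorem Expr.relabel_congr {α : Type u} [DecidableEq α] {C : CyclicOperad.{u, v} α}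
    {S T : Finset α} (E : Expr C S) {π ρ : Equiv.Perm α} (hπ : ∀ x, x ∈ S ↔ π x ∈ T)
    (hρ : ∀ x, x ∈ S ↔ ρ x ∈ T) (h : ∀ x ∈ E.inputs, π x = ρ x) :
    E.relabel π hπ = E.relabel ρ hρ := by
  refine Expr.mk_eq_mk (Equiv.subtypeEquivRight fun x => ?_) (fun _ => rfl) ?_ ?_
  · simp only [Finset.mem_map, Equiv.coe_toEmbedding]
    exact exists_congr fun y => and_congr_right fun hy => by rw [h y hy]
  · rw [← C.map_trans]
    exact C.map_congr (fun i => h i i.2) _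
  · exact List.map_congr_left fun e he => Sym2.map_congr fun x hx =>
      h x (E.mem_inputs_of_mem_pairs he hx)

theorem Expr.relabel_relabel {α : Type u} [DecidableEq α] {C : CyclicOperad.{u, v} α}
    {S T R : Finset α} (E : Expr C S) (π ρ : Equiv.Perm α) (hπ : ∀ x, x ∈ S ↔ π x ∈ T)
    (hρ : ∀ x, x ∈ T ↔ ρ x ∈ R) :
    (E.relabel π hπ).relabel ρ hρ =
      E.relabel (ρ * π) (fun x => (hπ x).trans (hρ _)) := by
  refine Expr.mk_eq_mk (Equiv.subtypeEquivRight fun x => ?_) (fun _ => rfl) ?_ ?_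
  · change x ∈ ((E.relabel π hπ).relabel ρ hρ).inputs ↔ 
      x ∈ (E.relabel (ρ * π) fun x => (hπ x).trans (hρ _)).inputs
    simp only [mem_inputs_relabel]
    rfl
  · simp only [relabel, ← C.map_trans]
    exact C.map_congr (fun i => rfl) _
  · simp [relabel, Sym2.map_comp]

theorem Expr.relabel_eq_self {α : Type u} [DecidableEq α] {C : CyclicOperad.{u, v} α}
    {S : Finset α} (E : Expr C S) {π : Equiv.Perm α} (hπ : ∀ x, x ∈ S ↔ π x ∈ S)
    (h : ∀ x ∈ E.inputs, π x = x) : E.relabel π hπ = E := by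
  rw [E.relabel_congr hπ (ρ := 1) (by simp) h]
  refine Expr.mk_eq_mk (Equiv.subtypeEquivRight fun x => ?_) (fun _ => rfl) ?_ ?_
  · simp [Equiv.Perm.one_def]
  · rw [← C.map_trans]
    exact C.map_id (fun i => rfl) _
  · simp

/-! ### Classes of expressions -/

/-- Expressions up to moves. -/
def MoveClass {α : Type u} [DecidableEq α] (C : CyclicOperad.{u, v} α) (S : Finset α) :
    Type (max u v) :=
  Quot (Move (C := C) (S := S))

/-- The class of an expression up to moves. -/
def Expr.cls {α : Type u} [DecidableEq α] {C : CyclicOperad.{u, v} α} {S : Finset α}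
    (E : Expr C S) : MoveClass C S :=
  Quot.mk _ E

/-- Move (i) is symmetric in its two gluings, (ii) is undone by the inverse bijection, and (iii) by
the inverse permutation. -/
theorem Move.symm {α : Type u} [DecidableEq α] {C : CyclicOperad.{u, v} α} {S : Finset α}
    {E F : Expr C S} (h : Move E F) : Move F E := by
  cases h with
  | exchange w' w'' l hq hp hU hV => exact .exchange w' w'' l hp hq hV hU
  | @relabel p' p'' q' q'' X X' y l ρ hp' hp'' hρ hX hX' =>
    have hmem : p' ∈ X ∧ p'' ∈ X := by
      rw [contracts_iff] at hX
      simp [hX.2.2.2]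
    have hq' := hp' ⟨p', hmem.1⟩ rfl
    have hq'' := hp'' ⟨p'', hmem.2⟩ rfl
    have key : C.map ρ.symm (C.map ρ y) = y := by
      rw [← C.map_trans, Equiv.self_trans_symm, C.map_refl]
    have := Move.relabel (S := S) (p' := q') (p'' := q'') (q' := p') (q'' := p'') (C.map ρ y) l
      ρ.symm (fun i hi => ?_) (fun i hi => ?_) (fun i hi hi' => ?_) hX' hX
    · rwa [key] at this
    · rw [show i = ρ ⟨p', hmem.1⟩ from Subtype.ext (hi.trans hq'.symm)]; simp
    · rw [show i = ρ ⟨p'', hmem.2⟩ from Subtype.ext (hi.trans hq''.symm)]; simp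
    · obtain ⟨j, rfl⟩ := ρ.surjective i
      rw [Equiv.symm_apply_apply]
      exact (hρ j (fun h => hi (hp' j h)) (fun h => hi' (hp'' j h))).symm
  | permute y hl h h' => exact .permute y hl.symm h' h

theorem Expr.cls_eq_cls {α : Type u} [DecidableEq α] {C : CyclicOperad.{u, v} α} {S : Finset α}
    {E F : Expr C S} : E.cls = F.cls ↔ Relation.ReflTransGen Move E F := by
  constructor
  · intro h
    replace h := Quot.eqvGen_exact h
    induction h with
    | rel _ _ h => exact .single h
    | refl => exact .refl
    | symm x y _ ih =>
      have : Std.Symm (Move (C := C) (S := S)) := ⟨fun _ _ => Move.symm⟩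
      exact Relation.ReflTransGen.stdSymm.symm _ _ ih
    | trans x y z _ _ ih ih' => exact ih.trans ih'
  · intro h
    induction h with
    | refl => rfl
    | tail _ h ih => exact ih.trans (Quot.sound h)

/-! ### Moves (ii) and (iii) generate all renamings of contracted labels. -/

theorem Expr.cls_eq_of_perm {α : Type u} [DecidableEq α] {C : CyclicOperad.{u, v} α}
    {S X : Finset α} (y : C.obj X) {l l' : List (Sym2 α)} (hl : l.Perm l')
    (h : Contracts l X S) (h' : Contracts l' X S) :
    (⟨X, y, l, h⟩ : Expr C S).cls = Expr.cls ⟨X, y, l', h'⟩ :=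
  Quot.sound (.permute y hl h h')

/-- The label `a` lies in some contracted pair `s(a, c)`. Move (iii) brings this pair to the
innermost place, and move (ii) replaces it by `s(b, c)`. -/
theorem Expr.cls_relabel_swap_of_notMem {α : Type u} [DecidableEq α] {C : CyclicOperad.{u, v} α}
    {S : Finset α} (E : Expr C S) {a b : α} (ha : a ∉ S)
    (haE : a ∈ E.inputs) (hbE : b ∉ E.inputs)
    (h : ∀ x, x ∈ S ↔ Equiv.swap a b x ∈ S) : (E.relabel (Equiv.swap a b) h).cls = E.cls := by
  obtain ⟨X, y, l, hl⟩ := E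
  have hl' := contracts_iff.1 hl
  dsimp only at haE hbE
  obtain ⟨e, he, hae⟩ := ((hl'.2.2.2 a).1 haE).resolve_left ha
  obtain ⟨c, rfl⟩ := hae
  obtain ⟨l₁, l₂, rfl⟩ := List.append_of_mem he
  have hperm : (l₁ ++ s(a, c) :: l₂).Perm ((l₁ ++ l₂) ++ [s(a, c)]) := by grind
  have h₁ := hl.perm hperm
  have h₁' := contracts_iff.1 h₁
  have hac : a ≠ c := by simpa using hl'.1 _ he
  have hcX : c ∈ X := (hl'.2.2.2 c).2 (.inr ⟨_, he, by simp⟩)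
  have hbc : b ≠ c := fun h => hbE (h ▸ hcX)
  -- The other pairs avoid `a` because pairs are disjoint, and avoid `b` because `b` is not an
  -- input.
  have hfix : (l₁ ++ l₂).map (Sym2.map (Equiv.swap a b)) = l₁ ++ l₂ := by
    refine (List.map_congr_left fun f hf => ?_).trans (List.map_id _)
    refine (Sym2.map_congr fun x hx => ?_).trans (congrFun Sym2.map_id' f)
    have hx₁ : x ≠ a := fun hxa => by
      have := (List.pairwise_append.1 h₁'.2.1).2.2 f hf s(a, c) (by simp) x hx
      simp [hxa] at this
    have hx₂ : x ≠ b := fun hxb => hbE (hxb ▸ (h₁'.2.2.2 x).2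
      (.inr ⟨f, by simp at hf ⊢; tauto, hx⟩))
    exact Equiv.swap_apply_of_ne_of_ne hx₁ hx₂
  have h₂ := h₁.map_perm (Equiv.swap a b) (X' := X.map (Equiv.swap a b).toEmbedding) (by simp) h
  have key : ((l₁ ++ l₂) ++ [s(a, c)]).map (Sym2.map (Equiv.swap a b)) =
      (l₁ ++ l₂) ++ [s(b, c)] := by
    rw [List.map_append, hfix]
    simp [Equiv.swap_apply_of_ne_of_ne hac.symm hbc.symm]
  rw [Expr.cls_eq_of_perm y hperm hl h₁]
  refine Eq.trans (Expr.cls_eq_of_perm _ (hperm.map _) _ h₂) ?_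
  rw [key] at h₂
  simp only [key]
  refine (Quot.sound (Move.relabel y (l₁ ++ l₂) _ ?_ ?_ ?_ h₁ h₂)).symm
  · intro i hi
    simp [hi]
  · intro i hi
    simp [hi, Equiv.swap_apply_of_ne_of_ne hac.symm hbc.symm]
  · intro i hi hi'
    simp only [Equiv.subtypeEquiv_apply]
    exact Equiv.swap_apply_of_ne_of_ne hi fun h => hbE (h ▸ i.2)

theorem Expr.cls_relabel_swap {α : Type u} [DecidableEq α] [Infinite α]
    {C : CyclicOperad.{u, v} α} {S : Finset α} (E : Expr C S) {a b : α} (ha : a ∉ S)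
    (hb : b ∉ S) (h : ∀ x, x ∈ S ↔ Equiv.swap a b x ∈ S) :
    (E.relabel (Equiv.swap a b) h).cls = E.cls := by
  by_cases haE : a ∈ E.inputs <;> by_cases hbE : b ∈ E.inputs
  · obtain rfl | hab := eq_or_ne a b
    · rw [E.relabel_eq_self h (by simp)]
    have hsw : ∀ {c d : α}, c ∉ S → d ∉ S → ∀ x, x ∈ S ↔ Equiv.swap c d x ∈ S := by
      intro c d hc hd x
      rw [Equiv.swap_apply_def]
      grind
    obtain ⟨c, hc⟩ := Infinite.exists_notMem_finset E.inputs
    have hcS : c ∉ S := fun h => hc (E.contracts.subset h)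
    have hca : c ≠ a := fun h => hc (h ▸ haE)
    have hcb : c ≠ b := fun h => hc (h ▸ hbE)
    -- Both labels are in use, so they are exchanged through an unused label `c`: `a` to `c`, then
    -- `b` to `a`, then `c` to `b`.
    have h₁ := E.cls_relabel_swap_of_notMem ha haE hc (hsw ha hcS)
    have h₂ := (E.relabel _ (hsw ha hcS)).cls_relabel_swap_of_notMem hb
      (by simpa [mem_inputs_relabel, Equiv.swap_apply_of_ne_of_ne hab.symm hcb.symm])
      (by simpa [mem_inputs_relabel]) (hsw hb ha)
    have h₃ := ((E.relabel _ (hsw ha hcS)).relabel _ (hsw hb ha)).cls_relabel_swap_of_notMem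
      hcS
      (by simpa [mem_inputs_relabel, Equiv.swap_apply_of_ne_of_ne hcb hca])
      (by simpa [mem_inputs_relabel]) (hsw hcS hb)
    rw [h₂, h₁, relabel_relabel, relabel_relabel] at h₃
    rw [← h₃]
    refine congrArg _ (E.relabel_congr _ _ fun x hx => ?_)
    simp only [Equiv.Perm.mul_apply, Equiv.swap_apply_def]
    grind
  · exact E.cls_relabel_swap_of_notMem ha haE hbE h
  · rw [← E.cls_relabel_swap_of_notMem hb hbE haE (by simpa only [Equiv.swap_comm] using h)]
    simp only [Equiv.swap_comm]
  · rw [E.relabel_eq_self]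
    exact fun x hx => Equiv.swap_apply_of_ne_of_ne (fun h => haE (h ▸ hx)) fun h => hbE (h ▸ hx)

/-- The labels along which an expression is contracted can be renamed. -/
theorem Expr.cls_relabel_of_fixed {α : Type u} [DecidableEq α] [Infinite α]
    {C : CyclicOperad.{u, v} α} {S : Finset α} (E : Expr C S) (π : Equiv.Perm α)
    (hπ : ∀ x ∈ S, π x = x) (h : ∀ x, x ∈ S ↔ π x ∈ S) : (E.relabel π h).cls = E.cls := by
  -- Induction on the number of inputs moved by `π`: following `π` by the transposition of `x` and
  -- `π x` fixes `x` and keeps every fixed point.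
  induction hn : (E.inputs.filter fun x => π x ≠ x).card using Nat.strong_induction_on
    generalizing π with
  | _ n ih =>
    by_cases hE : ∀ x ∈ E.inputs, π x = x
    · rw [E.relabel_eq_self h hE]
    push Not at hE
    obtain ⟨x, hx, hne⟩ := hE
    have hxS : x ∉ S := fun h => hne (hπ x h)
    have hxS' : π x ∉ S := fun h' => hxS ((h x).2 h')
    have hsw : ∀ y, y ∈ S ↔ Equiv.swap x (π x) y ∈ S := by
      intro y
      rw [Equiv.swap_apply_def]
      grind
    have hfix : ∀ y, π y = y → Equiv.swap x (π x) (π y) = y := by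
      intro y hy
      rw [hy]
      refine Equiv.swap_apply_of_ne_of_ne (fun h => hne (h ▸ hy)) fun h => hne ?_
      rw [← π.injective (hy.trans h), hy]
    have hfix' : ∀ y ∈ S, (Equiv.swap x (π x) * π) y = y := fun y hy => hfix y (hπ y hy)
    have h' : ∀ y, y ∈ S ↔ (Equiv.swap x (π x) * π) y ∈ S := fun y => (h y).trans (hsw _)
    have := ih _ (by
      rw [← hn]
      refine Finset.card_lt_card (Finset.ssubset_iff_of_subset ?_ |>.2 ⟨x, by simp [hx, hne], ?_⟩)
      · intro y
        simp only [Finset.mem_filter]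
        exact fun hy => ⟨hy.1, fun h => hy.2 (hfix y h)⟩
      · exact fun h => (Finset.mem_filter.1 h).2 (Equiv.swap_apply_right _ _))
      (Equiv.swap x (π x) * π) hfix' h' rfl
    rw [← this, ← (E.relabel _ h').cls_relabel_swap hxS hxS' hsw, relabel_relabel]
    refine congrArg _ (E.relabel_congr _ _ fun y _ => ?_)
    simp

/-! ### Compositions and contractions of expressions -/

theorem map_comp {α : Type u} [DecidableEq α] (C : CyclicOperad.{u, v} α) {a b : α}
    {X Y Z Z' : Finset α} (h : IsGluing a b X Y Z) (h' : IsGluing a b X Y Z') (σ : Z ≃ Z')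
    (hσ : ∀ i, (σ i : α) = i) (x : C.obj X) (y : C.obj Y) :
    C.map σ (C.comp h x y) = C.comp h' x y := by
  rw [← C.comp_map h h' (Equiv.refl X) (Equiv.refl Y) σ rfl rfl
    (fun i j hij => hij.trans (hσ j).symm) (fun i j hij => hij.trans (hσ j).symm),
    C.map_refl, C.map_refl]

/-- The composition of two expressions without common labels. -/
def Expr.glue {α : Type u} [DecidableEq α] {C : CyclicOperad.{u, v} α} {a b : α}
    {S T R : Finset α} (h : IsGluing a b S T R) (E : Expr C S) (F : Expr C T)
    (hd : Disjoint E.inputs F.inputs) : Expr C R where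
  inputs := E.inputs.erase a ∪ F.inputs.erase b
  elt := C.comp (h.of_contracts E.contracts F.contracts hd) E.elt F.elt
  pairs := F.pairs ++ E.pairs
  contracts := E.contracts.glue F.contracts h (h.of_contracts E.contracts F.contracts hd)

/-- The contraction of an expression. -/
def Expr.contr {α : Type u} [DecidableEq α] {C : CyclicOperad.{u, v} α} {e : Sym2 α}
    {S Z : Finset α} (h : IsContraction e S Z) (E : Expr C S) : Expr C Z where
  inputs := E.inputs
  elt := E.elt
  pairs := e :: E.pairs
  contracts := Contracts.cons h E.contracts

theorem disjoint_inputs_relabel {α : Type u} [DecidableEq α] {C : CyclicOperad.{u, v} α}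
    {S T S' T' : Finset α} {E : Expr C S} {F : Expr C T} {π : Equiv.Perm α}
    (hd : Disjoint E.inputs F.inputs) (hS : ∀ x, x ∈ S ↔ π x ∈ S') (hT : ∀ x, x ∈ T ↔ π x ∈ T') :
    Disjoint (E.relabel π hS).inputs (F.relabel π hT).inputs := by
  rw [Finset.disjoint_left] at *
  intro x
  rw [Expr.mem_inputs_relabel, Expr.mem_inputs_relabel]
  exact fun h => hd h

/-- Using a permutation of all labels lets the same `π` act on both factors and on the result, so
this is equivariance of the composition in `C`. -/
theorem Expr.relabel_glue {α : Type u} [DecidableEq α] {C : CyclicOperad.{u, v} α} {a b a' b' : α}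
    {S T R S' T' R' : Finset α} (h : IsGluing a b S T R) (h' : IsGluing a' b' S' T' R')
    (E : Expr C S) (F : Expr C T) (hd : Disjoint E.inputs F.inputs) {π : Equiv.Perm α}
    (ha : π a = a') (hb : π b = b') (hS : ∀ x, x ∈ S ↔ π x ∈ S') (hT : ∀ x, x ∈ T ↔ π x ∈ T')
    (hR : ∀ x, x ∈ R ↔ π x ∈ R') :
    (E.glue h F hd).relabel π hR =
      (E.relabel π hS).glue h' (F.relabel π hT) (disjoint_inputs_relabel hd hS hT) := by
  subst ha hb
  have hX : ∀ x, x ∈ (E.glue h F hd).inputs ↔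
      π x ∈ ((E.relabel π hS).glue h' (F.relabel π hT)
        (disjoint_inputs_relabel hd hS hT)).inputs := by
    intro x
    simp [glue, mem_inputs_relabel]
  refine Expr.mk_eq_mk (Equiv.subtypeEquivRight fun x => ?_) (fun _ => rfl) ?_ ?_
  · obtain ⟨x, rfl⟩ := π.surjective x
    exact Iff.trans (by simp) (hX x)
  · have hg := h.of_contracts E.contracts F.contracts hd
    have hg' := h'.of_contracts (E.relabel π hS).contracts (F.relabel π hT).contracts
      (disjoint_inputs_relabel hd hS hT)
    refine (C.map_trans _ _ _).symm.trans (Eq.trans ?_ (C.comp_map hg hg'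
      (π.subtypeEquiv (by simp [relabel])) (π.subtypeEquiv (by simp [relabel]))
      (π.subtypeEquiv hX) rfl rfl ?_ ?_ E.elt F.elt).symm)
    · exact C.map_congr (fun i => rfl) _
    · exact fun i j hij => congrArg π hij
    · exact fun i j hij => congrArg π hij
  · exact List.map_append

theorem Expr.relabel_contr {α : Type u} [DecidableEq α] {C : CyclicOperad.{u, v} α}
    {e e' : Sym2 α} {S Z S' Z' : Finset α} (h : IsContraction e S Z) (h' : IsContraction e' S' Z')
    (E : Expr C S) {π : Equiv.Perm α} (he : e.map π = e') (hS : ∀ x, x ∈ S ↔ π x ∈ S')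
    (hZ : ∀ x, x ∈ Z ↔ π x ∈ Z') :
    (E.contr h).relabel π hZ = (E.relabel π hS).contr h' := by
  subst he
  rfl

/-- The elements agree by symmetry in `C`, but the two lists of pairs are concatenated in opposite
orders; move (iii) is needed. -/
theorem Expr.cls_glue_comm {α : Type u} [DecidableEq α] {C : CyclicOperad.{u, v} α} {a b : α}
    {S T R : Finset α} (h : IsGluing a b S T R) (h' : IsGluing b a T S R) (E : Expr C S)
    (F : Expr C T) (hd : Disjoint E.inputs F.inputs) :
    (E.glue h F hd).cls = (F.glue h' E hd.symm).cls := by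
  have : E.glue h F hd = ⟨(F.glue h' E hd.symm).inputs, (F.glue h' E hd.symm).elt,
      F.pairs ++ E.pairs, (F.glue h' E hd.symm).contracts.perm List.perm_append_comm⟩ := by
    refine Expr.mk_eq_mk (Equiv.subtypeEquivRight fun x => ?_) (fun _ => rfl) ?_ rfl
    · simp [glue, or_comm]
    · have hg := h.of_contracts E.contracts F.contracts hd
      rw [Finset.union_comm] at hg
      exact (C.map_comp _ hg _ (fun _ => rfl) _ _).trans (C.comp_comm _ _ _ _)
  rw [this]
  exact Expr.cls_eq_of_perm _ List.perm_append_comm _ _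

theorem Expr.cls_glue_assoc {α : Type u} [DecidableEq α] {C : CyclicOperad.{u, v} α}
    {a b c d : α} {X Y Z XY YZ W : Finset α}
    (h₁ : IsGluing a b X Y XY) (h₂ : IsGluing c d XY Z W)
    (h₃ : IsGluing c d Y Z YZ) (h₄ : IsGluing a b X YZ W)
    (E : Expr C X) (F : Expr C Y) (G : Expr C Z) (hEF : Disjoint E.inputs F.inputs)
    (hFG : Disjoint F.inputs G.inputs)
    (hd : Disjoint (E.glue h₁ F hEF).inputs G.inputs)
    (hd' : Disjoint E.inputs (F.glue h₃ G hFG).inputs) :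
    ((E.glue h₁ F hEF).glue h₂ G hd).cls = (E.glue h₄ (F.glue h₃ G hFG) hd').cls := by
  have hI : ((E.glue h₁ F hEF).glue h₂ G hd).inputs = (E.glue h₄ (F.glue h₃ G hFG) hd').inputs := by
    have hb := F.contracts.subset h₁.mem_right
    have hc := F.contracts.subset h₃.mem_left
    have h₅ := Finset.disjoint_left.1 hEF
    have h₇ := Finset.disjoint_left.1 hFG
    ext x
    simp only [glue, Finset.mem_union, Finset.mem_erase]
    grind
  have hg : IsGluing a b E.inputs (F.glue h₃ G hFG).inputs
      ((E.glue h₁ F hEF).glue h₂ G hd).inputs :=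
    hI ▸ h₄.of_contracts E.contracts (F.glue h₃ G hFG).contracts hd'
  have : E.glue h₄ (F.glue h₃ G hFG) hd' = ⟨((E.glue h₁ F hEF).glue h₂ G hd).inputs,
      ((E.glue h₁ F hEF).glue h₂ G hd).elt, (G.pairs ++ F.pairs) ++ E.pairs,
      ((E.glue h₁ F hEF).glue h₂ G hd).contracts.perm (by simp [glue])⟩ := by
    refine Expr.mk_eq_mk (Equiv.subtypeEquivRight fun x => by rw [hI]; rfl) (fun _ => rfl) ?_ rfl
    exact (C.map_comp _ hg _ (fun _ => rfl) _ _).trans (C.comp_assoc _ _ _ _ _ _ _).symm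
  rw [this]
  exact Expr.cls_eq_of_perm _ (by simp [glue]) _ _

/-- The class of the composition of two expressions does not depend on the labels along which they
are contracted. -/
theorem Expr.cls_glue_relabel {α : Type u} [DecidableEq α] [Infinite α]
    {C : CyclicOperad.{u, v} α} {a b : α} {S T R : Finset α} (h : IsGluing a b S T R)
    (E : Expr C S) (F : Expr C T) (hd : Disjoint E.inputs F.inputs) {π ρ : Equiv.Perm α}
    (hπ : ∀ x ∈ S, π x = x) (hρ : ∀ x ∈ T, ρ x = x) (hS : ∀ x, x ∈ S ↔ π x ∈ S)
    (hT : ∀ x, x ∈ T ↔ ρ x ∈ T)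
    (hd' : Disjoint (E.relabel π hS).inputs (F.relabel ρ hT).inputs) :
    ((E.relabel π hS).glue h (F.relabel ρ hT) hd').cls = (E.glue h F hd).cls := by
  -- The inputs are disjoint before and after relabelling, so `π` on `E` and `ρ` on `F` combine to
  -- one injective map. Its extension `τ` fixes `R`, which reduces the claim to a renaming of the
  -- glued expression.
  obtain ⟨τ, hτ⟩ := exists_perm_eqOn (A := E.inputs ∪ F.inputs)
    (f := fun x => if x ∈ E.inputs then π x else ρ x) (by
      have key : ∀ x ∈ E.inputs, ∀ y ∈ F.inputs, π x ≠ ρ y := fun x hx y hy hxy =>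
        Finset.disjoint_left.1 hd' ((mem_inputs_relabel E π hS (π x)).2 (by simpa))
          ((mem_inputs_relabel F ρ hT (π x)).2 (by simpa [hxy]))
      intro x hx y hy hxy
      simp only [Finset.coe_union, Set.mem_union, Finset.mem_coe] at hx hy
      by_cases hx' : x ∈ E.inputs <;> by_cases hy' : y ∈ E.inputs <;>
        simp only [hx', hy', if_true, if_false] at hxy
      · exact π.injective hxy
      · exact (key x hx' y (hy.resolve_left hy') hxy).elim
      · exact (key y hy' x (hx.resolve_left hx') hxy.symm).elim
      · exact ρ.injective hxy)
  have h₁ : ∀ x ∈ E.inputs, π x = τ x := fun x hx => by simp [hτ x, hx]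
  have h₂ : ∀ x ∈ F.inputs, ρ x = τ x := fun x hx => by
    simp [hτ x, hx, Finset.disjoint_right.1 hd hx]
  have fixed : ∀ {A : Finset α}, (∀ x ∈ A, τ x = x) → ∀ x, x ∈ A ↔ τ x ∈ A := by
    intro A hA x
    refine ⟨fun hx => by rwa [hA x hx], fun hx => ?_⟩
    have := τ.injective (hA _ hx)
    rwa [this] at hx
  have hτS : ∀ x ∈ S, τ x = x := fun x hx => (h₁ x (E.contracts.subset hx)).symm.trans (hπ x hx)
  have hτT : ∀ x ∈ T, τ x = x := fun x hx => (h₂ x (F.contracts.subset hx)).symm.trans (hρ x hx)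
  have hτR : ∀ x ∈ R, τ x = x := by
    intro x hx
    rw [h.eq] at hx
    simp only [Finset.mem_union, Finset.mem_erase] at hx
    exact hx.elim (fun h => hτS x h.2) (fun h => hτT x h.2)
  rw [← (E.glue h F hd).cls_relabel_of_fixed τ hτR (fixed hτR),
    E.relabel_glue h h F hd (hτS a h.mem_left) (hτT b h.mem_right) (fixed hτS) (fixed hτT)]
  congr 2
  · exact E.relabel_congr _ _ h₁
  · exact F.relabel_congr _ _ h₂

/-- Moves (i) and (ii) act on the innermost contraction, at the end of the list, whereas a new
contraction is added at the front. -/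
theorem Move.contr_expr {α : Type u} [DecidableEq α] {C : CyclicOperad.{u, v} α} {e : Sym2 α}
    {S Z : Finset α} (h : IsContraction e S Z) {E F : Expr C S} (hEF : Move E F) :
    Move (E.contr h) (F.contr h) := by
  cases hEF with
  | exchange w' w'' l hq hp hU hV =>
    exact .exchange w' w'' (e :: l) hq hp (Contracts.cons h hU)
      (Contracts.cons h hV)
  | relabel y l ρ hp' hp'' hρ hX hX' =>
    exact .relabel y (e :: l) ρ hp' hp'' hρ (Contracts.cons h hX)
      (Contracts.cons h hX')
  | permute y hl h₁ h₂ => exact .permute y (hl.cons e) _ _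

/-! ### Renaming of the contracted labels -/

theorem mem_iff_of_fixed {α : Type u} {S : Finset α} {π : Equiv.Perm α} (hπ : ∀ x ∈ S, π x = x)
    (x : α) : x ∈ S ↔ π x ∈ S := by
  refine ⟨fun hx => by rwa [hπ x hx], fun hx => ?_⟩
  have := π.injective (hπ _ hx)
  rwa [this] at hx

/-- `F` is obtained from `E` by renaming the labels along which `E` is contracted. -/
def Expr.IsRenaming {α : Type u} [DecidableEq α] {C : CyclicOperad.{u, v} α} {S : Finset α}
    (E F : Expr C S) : Prop :=
  ∃ (π : Equiv.Perm α) (hπ : ∀ x ∈ S, π x = x), F = E.relabel π (mem_iff_of_fixed hπ)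

theorem Expr.IsRenaming.trans {α : Type u} [DecidableEq α] {C : CyclicOperad.{u, v} α}
    {S : Finset α} {E F G : Expr C S} (h : IsRenaming E F) (h' : IsRenaming F G) :
    IsRenaming E G := by
  obtain ⟨π, hπ, rfl⟩ := h
  obtain ⟨ρ, hρ, rfl⟩ := h'
  exact ⟨ρ * π, fun x hx => by simp [hπ x hx, hρ x hx], relabel_relabel ..⟩

theorem Expr.IsRenaming.symm {α : Type u} [DecidableEq α] {C : CyclicOperad.{u, v} α}
    {S : Finset α} {E F : Expr C S} (h : IsRenaming E F) : IsRenaming F E := by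
  obtain ⟨π, hπ, rfl⟩ := h
  refine ⟨π⁻¹, fun x hx => Equiv.Perm.inv_eq_iff_eq.2 (hπ x hx).symm, ?_⟩
  rw [relabel_relabel, relabel_eq_self]
  simp

theorem Expr.IsRenaming.cls_eq {α : Type u} [DecidableEq α] [Infinite α]
    {C : CyclicOperad.{u, v} α} {S : Finset α} {E F : Expr C S} (h : IsRenaming E F) :
    F.cls = E.cls := by
  obtain ⟨π, hπ, rfl⟩ := h
  exact E.cls_relabel_of_fixed π hπ _

theorem Expr.IsRenaming.cls_glue_eq {α : Type u} [DecidableEq α] [Infinite α]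
    {C : CyclicOperad.{u, v} α} {a b : α} {S T R : Finset α} (h : IsGluing a b S T R)
    {E E' : Expr C S} {F F' : Expr C T} (hE : IsRenaming E E') (hF : IsRenaming F F')
    (hd : Disjoint E.inputs F.inputs) (hd' : Disjoint E'.inputs F'.inputs) :
    (E'.glue h F' hd').cls = (E.glue h F hd).cls := by
  obtain ⟨π, hπ, rfl⟩ := hE
  obtain ⟨ρ, hρ, rfl⟩ := hF
  exact E.cls_glue_relabel h F hd hπ hρ _ _ hd'

theorem Expr.isRenaming_refl {α : Type u} [DecidableEq α] {C : CyclicOperad.{u, v} α}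
    {S : Finset α} (E : Expr C S) : IsRenaming E E :=
  ⟨1, fun _ _ => rfl, (E.relabel_eq_self _ fun _ _ => rfl).symm⟩

theorem Expr.exists_isRenaming_avoid {α : Type u} [DecidableEq α] [Infinite α]
    {C : CyclicOperad.{u, v} α} {S : Finset α} (E : Expr C S) (A : Finset α) :
    ∃ E', IsRenaming E E' ∧ ∀ x ∈ E'.inputs, x ∉ S → x ∉ A := by
  obtain ⟨π, hπ, hA⟩ := exists_perm_avoid E.inputs S A
  refine ⟨_, ⟨π, hπ, rfl⟩, fun x hx hxS => ?_⟩
  rw [mem_inputs_relabel] at hx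
  rw [← π.apply_symm_apply x] at hxS ⊢
  exact hA _ hx fun h => hxS ((mem_iff_of_fixed hπ _).1 h)

theorem Expr.exists_isRenaming_disjoint {α : Type u} [DecidableEq α] [Infinite α]
    {C : CyclicOperad.{u, v} α} {S T : Finset α} (hd : Disjoint S T) (E : Expr C S)
    (F : Expr C T) :
    ∃ E' F', IsRenaming E E' ∧ IsRenaming F F' ∧ Disjoint E'.inputs F'.inputs := by
  obtain ⟨E', hE, hE'⟩ := E.exists_isRenaming_avoid T
  obtain ⟨F', hF, hF'⟩ := F.exists_isRenaming_avoid E'.inputs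
  refine ⟨E', F', hE, hF, ?_⟩
  rw [Finset.disjoint_left] at *
  grind

/-- Any extension of `ρ` to all labels fixes `S` and the pairs in `l`. Thus statements about
renamings cover move (ii). -/
theorem Expr.isRenaming_map {α : Type u} [DecidableEq α] {C : CyclicOperad.{u, v} α}
    {S X X' : Finset α} {p' p'' q' q'' : α} (y : C.obj X) (l : List (Sym2 α))
    (ρ : X ≃ X') (hp' : ∀ i : X, (i : α) = p' → (ρ i : α) = q')
    (hp'' : ∀ i : X, (i : α) = p'' → (ρ i : α) = q'')
    (hρ : ∀ i : X, (i : α) ≠ p' → (i : α) ≠ p'' → (ρ i : α) = i)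
    (hX : Contracts (l ++ [s(p', p'')]) X S) (hX' : Contracts (l ++ [s(q', q'')]) X' S) :
    Expr.IsRenaming ⟨X, y, l ++ [s(p', p'')], hX⟩ ⟨X', C.map ρ y, l ++ [s(q', q'')], hX'⟩ := by
  obtain ⟨π, hπ⟩ := exists_perm_eqOn (A := X) (f := fun x => if h : x ∈ X then ρ ⟨x, h⟩ else x) (by
    intro x hx y hy hxy
    rw [Finset.mem_coe] at hx hy
    simpa [hx, hy] using hxy)
  have hπ' : ∀ i : X, π i = ρ i := fun i => by simp [hπ i i.2]
  have hm := contracts_iff.1 hX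
  have hpm' : p' ∈ X := (hm.2.2.2 _).2 (.inr ⟨s(p', p''), by simp, by simp⟩)
  have hpm'' : p'' ∈ X := (hm.2.2.2 _).2 (.inr ⟨s(p', p''), by simp, by simp⟩)
  have hfix : ∀ x ∈ X, x ≠ p' → x ≠ p'' → π x = x := fun x hx h h' =>
    (hπ' ⟨x, hx⟩).trans (hρ ⟨x, hx⟩ h h')
  have hS : ∀ x ∈ S, π x = x := fun x hx => hfix x (hX.subset hx)
    (fun h => hm.2.2.1 s(p', p'') (by simp) p' (by simp) (h ▸ hx))
    (fun h => hm.2.2.1 s(p', p'') (by simp) p'' (by simp) (h ▸ hx))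
  have hl : l.map (Sym2.map π) = l := by
    refine (List.map_congr_left fun f hf => ?_).trans (List.map_id _)
    refine (Sym2.map_congr fun x hx => ?_).trans (congrFun Sym2.map_id' f)
    have := (List.pairwise_append.1 hm.2.1).2.2 f hf s(p', p'') (by simp) x hx
    simp only [Sym2.mem_iff, not_or] at this
    exact hfix x ((hm.2.2.2 x).2 (.inr ⟨f, by simp [hf], hx⟩)) this.1 this.2
  refine ⟨π, hS, (Expr.mk_eq_mk ((π.subtypeEquiv (p := (· ∈ X)) (by simp)).symm.trans ρ)
    (fun i => ?_) ?_ ?_).symm⟩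
  · obtain ⟨i, rfl⟩ := (π.subtypeEquiv (p := (· ∈ X)) (q := (· ∈ X.map π.toEmbedding))
      (by simp)).surjective i
    rw [Equiv.trans_apply, Equiv.symm_apply_apply]
    exact (hπ' i).symm
  · rw [← C.map_trans]
    exact C.map_congr (fun i => by simp) _
  · have h₁ : π p' = q' := (hπ' ⟨p', hpm'⟩).trans (hp' _ rfl)
    have h₂ : π p'' = q'' := (hπ' ⟨p'', hpm''⟩).trans (hp'' _ rfl)
    simp [hl, h₁, h₂]

/-! ### Moves under relabelling and gluing. -/

theorem Move.map_relabel {α : Type u} [DecidableEq α] {C : CyclicOperad.{u, v} α}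
    {S T : Finset α} {E F : Expr C S} (hEF : Move E F) (π : Equiv.Perm α)
    (h : ∀ x, x ∈ S ↔ π x ∈ T) : Move (E.relabel π h) (F.relabel π h) := by
  have sub (X : Finset α) : ∀ x, x ∈ X ↔ π x ∈ X.map π.toEmbedding := by simp
  cases hEF with
  | @exchange p' q' p'' q'' X Y U V w' w'' l hq hp hU hV =>
    have h₁ := C.comp_map hq (hq.map_perm π (sub X) (sub Y) (sub U)) (π.subtypeEquiv (sub X))
      (π.subtypeEquiv (sub Y)) (π.subtypeEquiv (sub U)) rfl rfl (fun i j hij => congrArg π hij)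
      (fun i j hij => congrArg π hij) w' w''
    have h₂ := C.comp_map hp (hp.map_perm π (sub X) (sub Y) (sub V)) (π.subtypeEquiv (sub X))
      (π.subtypeEquiv (sub Y)) (π.subtypeEquiv (sub V)) rfl rfl (fun i j hij => congrArg π hij)
      (fun i j hij => congrArg π hij) w' w''
    have hU' := hU.map_perm π (sub U) h
    have hV' := hV.map_perm π (sub V) h
    simp only [List.map_append, List.map_cons, List.map_nil, Sym2.map_mk] at hU' hV'
    simp only [Expr.relabel, ← h₁, ← h₂, List.map_append, List.map_cons, List.map_nil,
      Sym2.map_mk]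
    exact .exchange _ _ _ _ _ hU' hV'
  | @relabel p' p'' q' q'' X X' y l ρ hp' hp'' hρ hX hX' =>
    -- The relabelled move (ii) uses the conjugate of `ρ` by `π`.
    have h₁ : C.map (π.subtypeEquiv (sub X')) (C.map ρ y) =
        C.map ((π.subtypeEquiv (sub X)).symm.trans (ρ.trans (π.subtypeEquiv (sub X'))))
          (C.map (π.subtypeEquiv (sub X)) y) := by
      simp only [← C.map_trans]
      exact C.map_congr (fun i => by simp) _
    have hU' := hX.map_perm π (sub X) h
    have hV' := hX'.map_perm π (sub X') h
    simp only [List.map_append, List.map_cons, List.map_nil, Sym2.map_mk] at hU' hV'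
    simp only [Expr.relabel, h₁, List.map_append, List.map_cons, List.map_nil, Sym2.map_mk]
    refine .relabel _ _ _ ?_ ?_ ?_ hU' hV'
    all_goals
      intro i
      obtain ⟨i, rfl⟩ := (π.subtypeEquiv (sub X)).surjective i
      rw [Equiv.trans_apply, Equiv.symm_apply_apply]
      simp only [Equiv.trans_apply, Equiv.subtypeEquiv_apply, ne_eq,
        EmbeddingLike.apply_eq_iff_eq]
    · exact hp' i
    · exact hp'' i
    · exact hρ i
  | permute y hl h h' => exact .permute _ (hl.map _) _ _

/-- Since `a` is an input of `w''`, associativity turns the glued element into a composite of `w'`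
with `w'' ∘ F.elt`, and move (i) applies to that composite. Keeping `e` and `f` as variables allows
reuse with the roles of `w'` and `w''`, and hence the order in each pair, reversed. -/
theorem Expr.cls_glue_exchange {α : Type u} [DecidableEq α] {C : CyclicOperad.{u, v} α}
    {a b p' q' p'' q'' : α} {S T R X Y U V : Finset α} (h : IsGluing a b S T R)
    (w' : C.obj X) (w'' : C.obj Y) {l : List (Sym2 α)} {e f : Sym2 α} (he : e = s(p', p''))
    (hf : f = s(q', q'')) (hq : IsGluing q' q'' X Y U) (hp : IsGluing p' p'' X Y V)
    (hU : Contracts (l ++ [e]) U S) (hV : Contracts (l ++ [f]) V S) (ha : a ∈ Y)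
    (F : Expr C T) (hd : Disjoint U F.inputs) (hd' : Disjoint V F.inputs) :
    (glue h ⟨U, C.comp hq w' w'', l ++ [e], hU⟩ F hd).cls =
      (glue h ⟨V, C.comp hp w' w'', l ++ [f], hV⟩ F hd').cls := by
  subst he hf
  have hUF := h.of_contracts hU F.contracts hd
  have hVF := h.of_contracts hV F.contracts hd'
  have hU₁ := (contracts_iff.1 hU).2.2.1 s(p', p'') (by simp)
  have hV₁ := (contracts_iff.1 hV).2.2.1 s(q', q'') (by simp)
  have haS := h.mem_left
  have hne : a ≠ p' ∧ a ≠ p'' ∧ a ≠ q' ∧ a ≠ q'' :=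
    ⟨fun h => hU₁ p' (by simp) (h ▸ haS), fun h => hU₁ p'' (by simp) (h ▸ haS),
      fun h => hV₁ q' (by simp) (h ▸ haS), fun h => hV₁ q'' (by simp) (h ▸ haS)⟩
  have hV₂ : q' ∈ V ∧ q'' ∈ V := by simp [(contracts_iff.1 hV).2.2.2]
  have h₁ := isGluing_iff.1 hq
  have h₂ := isGluing_iff.1 hp
  have hd₁ := Finset.disjoint_left.1 hd
  have hd₂ := Finset.disjoint_left.1 hd'
  have hbF := hUF.mem_right
  have hY : IsGluing a b Y F.inputs (Y.erase a ∪ F.inputs.erase b) :=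
    ⟨ha, hbF, Finset.disjoint_left.2 (by grind), rfl⟩
  have hq' : IsGluing q' q'' X (Y.erase a ∪ F.inputs.erase b)
      (U.erase a ∪ F.inputs.erase b) := by
    simp only [isGluing_iff, Finset.mem_union, Finset.mem_erase]
    grind
  have hp' : IsGluing p' p'' X (Y.erase a ∪ F.inputs.erase b)
      (V.erase a ∪ F.inputs.erase b) := by
    simp only [isGluing_iff, Finset.mem_union, Finset.mem_erase]
    grind
  have e₁ := C.comp_assoc hq hUF hY hq' w' w'' F.elt
  have e₂ := C.comp_assoc hp hVF hY hp' w' w'' F.elt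
  have c₁ := hU.glue F.contracts h hUF
  have c₂ := hV.glue F.contracts h hVF
  rw [← List.append_assoc] at c₁ c₂
  simp only [glue, e₁, e₂, ← List.append_assoc]
  exact Quot.sound (.exchange _ _ _ _ _ c₁ c₂)

theorem Move.cls_glue_eq {α : Type u} [DecidableEq α] [Infinite α] {C : CyclicOperad.{u, v} α}
    {a b : α} {S T R : Finset α} (h : IsGluing a b S T R) {E E' : Expr C S} (hE : Move E E')
    (F : Expr C T) (hd : Disjoint E.inputs F.inputs) (hd' : Disjoint E'.inputs F.inputs) :
    (E.glue h F hd).cls = (E'.glue h F hd').cls := by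
  cases hE with
  | @exchange p' q' p'' q'' X Y U V w' w'' l hq hp hU hV =>
    by_cases haY : a ∈ Y
    · exact Expr.cls_glue_exchange h w' w'' rfl rfl hq hp hU hV haY F hd hd'
    · have haX : a ∈ X := by
        have := hU.subset h.mem_left
        rw [hq.eq] at this
        grind
      -- Now `a` is an input of `w'`; symmetry of the composition reduces to the previous case.
      simp only [C.comp_comm hq hq.symm w' w'', C.comp_comm hp hp.symm w' w'']
      exact Expr.cls_glue_exchange h w'' w' Sym2.eq_swap Sym2.eq_swap hq.symm hp.symm hU hV haX
        F hd hd'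
  | relabel y l ρ hp' hp'' hρ hX hX' =>
    exact ((Expr.isRenaming_map y l ρ hp' hp'' hρ hX hX').cls_glue_eq h F.isRenaming_refl _ _).symm
  | permute y hl h₁ h₂ => exact Expr.cls_eq_of_perm _ (hl.append_left _) _ _

/-! ### The modular operad of classes of expressions -/

/-- A bijection of finite sets of labels extends to a permutation of all labels. -/
theorem exists_perm_extend {α : Type u} {S T : Finset α} (σ : S ≃ T) :
    ∃ π : Equiv.Perm α, ∀ i : S, π i = σ i := by
  classical
  obtain ⟨π, hπ⟩ := exists_perm_eqOn (A := S) (f := fun x => if h : x ∈ S then σ ⟨x, h⟩ else x) (by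
    intro x hx y hy hxy
    rw [Finset.mem_coe] at hx hy
    simpa [hx, hy] using hxy)
  exact ⟨π, fun i => by simp [hπ i i.2]⟩

theorem mem_iff_of_extend {α : Type u} {S T : Finset α} {σ : S ≃ T} {π : Equiv.Perm α}
    (hπ : ∀ i : S, π i = σ i) (x : α) : x ∈ S ↔ π x ∈ T := by
  refine ⟨fun hx => by rw [hπ ⟨x, hx⟩]; exact (σ ⟨x, hx⟩).2, fun hx => ?_⟩
  have := hπ (σ.symm ⟨π x, hx⟩)
  rw [Equiv.apply_symm_apply] at this
  exact π.injective this ▸ (σ.symm ⟨π x, hx⟩).2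

/-- Relabelling of classes of expressions. -/
noncomputable def MoveClass.map {α : Type u} [DecidableEq α] {C : CyclicOperad.{u, v} α}
    {S T : Finset α} (σ : S ≃ T) : MoveClass C S → MoveClass C T :=
  Quot.map (fun E => E.relabel _ (mem_iff_of_extend (exists_perm_extend σ).choose_spec))
    fun _ _ h => h.map_relabel _ _

/-- Two extensions of `σ` differ by a permutation fixing `T`, that is, by a renaming, so the chosen
extension does not matter. -/
theorem MoveClass.map_cls {α : Type u} [DecidableEq α] [Infinite α] {C : CyclicOperad.{u, v} α}
    {S T : Finset α} (σ : S ≃ T) {π : Equiv.Perm α} (hπ : ∀ i : S, π i = σ i) (E : Expr C S) :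
    map σ E.cls = (E.relabel π (mem_iff_of_extend hπ)).cls := by
  obtain ⟨ρ, hρ, hE⟩ : ∃ (ρ : Equiv.Perm α) (hρ : ∀ i : S, ρ i = σ i),
      map σ E.cls = (E.relabel ρ (mem_iff_of_extend hρ)).cls :=
    ⟨_, (exists_perm_extend σ).choose_spec, rfl⟩
  rw [hE]
  refine Expr.IsRenaming.cls_eq ⟨ρ * π⁻¹, fun x hx => ?_, ?_⟩
  · have := (hπ (σ.symm ⟨x, hx⟩)).trans (by rw [Equiv.apply_symm_apply])
    rw [Equiv.Perm.mul_apply, Equiv.Perm.inv_eq_iff_eq.2 this.symm, hρ, Equiv.apply_symm_apply]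
  · rw [Expr.relabel_relabel]
    exact E.relabel_congr _ _ (by simp)

/-- Contraction of classes of expressions. -/
def MoveClass.contr {α : Type u} [DecidableEq α] {C : CyclicOperad.{u, v} α} {e : Sym2 α}
    {S Z : Finset α} (h : IsContraction e S Z) : MoveClass C S → MoveClass C Z :=
  Quot.map (Expr.contr h) fun _ _ hEF => hEF.contr_expr h

theorem MoveClass.contr_cls {α : Type u} [DecidableEq α] {C : CyclicOperad.{u, v} α} {e : Sym2 α}
    {S Z : Finset α} (h : IsContraction e S Z) (E : Expr C S) :
    contr h E.cls = (E.contr h).cls :=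
  rfl

/-- The composition of two expressions, after a renaming which makes their labels distinct. -/
noncomputable def Expr.compClass {α : Type u} [DecidableEq α] [Infinite α]
    {C : CyclicOperad.{u, v} α} {a b : α} {S T R : Finset α} (h : IsGluing a b S T R) (E : Expr C S) (F : Expr C T) : MoveClass C R :=
  (glue h _ _ (exists_isRenaming_disjoint h.disjoint E F).choose_spec.choose_spec.2.2).cls

theorem Expr.compClass_eq {α : Type u} [DecidableEq α] [Infinite α] {C : CyclicOperad.{u, v} α}
    {a b : α} {S T R : Finset α} (h : IsGluing a b S T R) {E E' : Expr C S} {F F' : Expr C T}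
    (hE : IsRenaming E E') (hF : IsRenaming F F') (hd : Disjoint E'.inputs F'.inputs) :
    compClass h E F = (E'.glue h F' hd).cls := by
  have hs := (exists_isRenaming_disjoint h.disjoint E F).choose_spec.choose_spec
  exact (hE.symm.trans hs.1).cls_glue_eq h (hF.symm.trans hs.2.1) hd hs.2.2

theorem Expr.compClass_comm {α : Type u} [DecidableEq α] [Infinite α]
    {C : CyclicOperad.{u, v} α} {a b : α} {S T R : Finset α} (h : IsGluing a b S T R)
    (h' : IsGluing b a T S R) (E : Expr C S) (F : Expr C T) :
    compClass h E F = compClass h' F E := by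
  obtain ⟨E', F', hE, hF, hd⟩ := exists_isRenaming_disjoint h.disjoint E F
  rw [compClass_eq h hE hF hd, compClass_eq h' hF hE hd.symm]
  exact E'.cls_glue_comm h h' F' hd

theorem Move.compClass_eq {α : Type u} [DecidableEq α] [Infinite α] {C : CyclicOperad.{u, v} α}
    {a b : α} {S T R : Finset α} (h : IsGluing a b S T R) {E E' : Expr C S} (hE : Move E E')
    (F : Expr C T) : E.compClass h F = E'.compClass h F := by
  obtain ⟨F', hF, hF'⟩ := F.exists_isRenaming_avoid S
  -- One permutation must serve for `E` and `E'` together, so that their relabellings are still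
  -- related by a single move.
  obtain ⟨π, hπ, hA⟩ := exists_perm_avoid (E.inputs ∪ E'.inputs) S F'.inputs
  have key : ∀ G : Expr C S, G.inputs ⊆ E.inputs ∪ E'.inputs →
      Disjoint (G.relabel π (mem_iff_of_fixed hπ)).inputs F'.inputs := by
    intro G hG
    rw [Finset.disjoint_left]
    intro x hx
    rw [Expr.mem_inputs_relabel] at hx
    by_cases hxS : x ∈ S
    · exact fun h' => hF' x h' (Finset.disjoint_left.1 h.disjoint hxS) hxS
    · rw [← π.apply_symm_apply x] at hxS ⊢
      exact hA _ (hG hx) fun h => hxS ((mem_iff_of_fixed hπ _).1 h)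
  rw [Expr.compClass_eq h ⟨π, hπ, rfl⟩ hF (key E Finset.subset_union_left),
    Expr.compClass_eq h ⟨π, hπ, rfl⟩ hF (key E' Finset.subset_union_right)]
  exact (hE.map_relabel π _).cls_glue_eq h F' _ _

/-- Composition of classes of expressions. -/
noncomputable def MoveClass.comp {α : Type u} [DecidableEq α] [Infinite α]
    {C : CyclicOperad.{u, v} α} {a b : α} {S T R : Finset α} (h : IsGluing a b S T R) :
    MoveClass C S → MoveClass C T → MoveClass C R :=
  Quot.lift₂ (Expr.compClass h)
    (fun E F F' hF => by
      rw [Expr.compClass_comm h h.symm, Expr.compClass_comm h h.symm, hF.compClass_eq])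
    fun E E' F hE => hE.compClass_eq h F

theorem MoveClass.comp_cls {α : Type u} [DecidableEq α] [Infinite α] {C : CyclicOperad.{u, v} α}
    {a b : α} {S T R : Finset α} (h : IsGluing a b S T R) (E : Expr C S) (F : Expr C T)
    (hd : Disjoint E.inputs F.inputs) : comp h E.cls F.cls = (E.glue h F hd).cls :=
  Expr.compClass_eq h E.isRenaming_refl F.isRenaming_refl hd

/-! ### Representatives and the operad axioms for classes. -/

theorem MoveClass.exists_rep {α : Type u} [DecidableEq α] [Infinite α]
    {C : CyclicOperad.{u, v} α} {S : Finset α} (x : MoveClass C S) (A : Finset α) :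
    ∃ E : Expr C S, x = E.cls ∧ ∀ i ∈ E.inputs, i ∉ S → i ∉ A := by
  obtain ⟨E, rfl⟩ := Quot.exists_rep x
  obtain ⟨E', hE, hA⟩ := E.exists_isRenaming_avoid A
  exact ⟨E', hE.cls_eq.symm, hA⟩

theorem MoveClass.exists_disjoint_reps {α : Type u} [DecidableEq α] [Infinite α]
    {C : CyclicOperad.{u, v} α} {S T : Finset α} (hd : Disjoint S T) (x : MoveClass C S)
    (y : MoveClass C T) :
    ∃ (E : Expr C S) (F : Expr C T), x = E.cls ∧ y = F.cls ∧ Disjoint E.inputs F.inputs := by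
  obtain ⟨E, rfl⟩ := Quot.exists_rep x
  obtain ⟨F, rfl⟩ := Quot.exists_rep y
  obtain ⟨E', F', hE, hF, hd'⟩ := Expr.exists_isRenaming_disjoint hd E F
  exact ⟨E', F', hE.cls_eq.symm, hF.cls_eq.symm, hd'⟩

theorem Move.length_eq {α : Type u} [DecidableEq α] {C : CyclicOperad.{u, v} α} {S : Finset α}
    {E F : Expr C S} (h : Move E F) : E.pairs.length = F.pairs.length := by
  cases h with
  | exchange => simp
  | relabel => simp
  | permute y hl => exact hl.length_eq

theorem MoveClass.comp_map {α : Type u} [DecidableEq α] [Infinite α]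
    {C : CyclicOperad.{u, v} α} {a b a' b' : α} {X Y Z X' Y' Z' : Finset α}
    (h : IsGluing a b X Y Z) (h' : IsGluing a' b' X' Y' Z')
    (σ : X ≃ X') (τ : Y ≃ Y') (ω : Z ≃ Z')
    (ha : (σ ⟨a, h.mem_left⟩ : α) = a') (hb : (τ ⟨b, h.mem_right⟩ : α) = b')
    (hσ : Agree σ ω) (hτ : Agree τ ω) (x : MoveClass C X) (y : MoveClass C Y) :
    comp h' (map σ x) (map τ y) = map ω (comp h x y) := by
  obtain ⟨E, F, rfl, rfl, hd⟩ := exists_disjoint_reps h.disjoint x y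
  -- Disjointness of `X` and `Y` and of `X'` and `Y'` lets `σ` and `τ` come from one permutation,
  -- which then also induces `ω`.
  obtain ⟨π, hπ⟩ := exists_perm_eqOn (A := X ∪ Y)
    (f := fun x => if hx : x ∈ X then σ ⟨x, hx⟩ else if hy : x ∈ Y then τ ⟨x, hy⟩ else x) (by
      have key : ∀ i j, (σ i : α) ≠ τ j := fun i j hij =>
        Finset.disjoint_left.1 h'.disjoint (σ i).2 (hij ▸ (τ j).2)
      intro x hx y hy hxy
      simp only [Finset.coe_union, Set.mem_union, Finset.mem_coe] at hx hy
      by_cases hx' : x ∈ X <;> by_cases hy' : y ∈ X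
      · simpa [hx', hy'] using hxy
      · simp only [hx', hy', hy.resolve_left hy', dite_true, dite_false] at hxy
        exact (key _ _ hxy).elim
      · simp only [hx', hy', hx.resolve_left hx', dite_true, dite_false] at hxy
        exact (key _ _ hxy.symm).elim
      · simpa [hx', hy', hx.resolve_left hx', hy.resolve_left hy'] using hxy)
  have h₁ : ∀ i : X, π i = σ i := fun i => by simp [hπ i (by simp)]
  have h₂ : ∀ i : Y, π i = τ i := fun i => by
    simp [hπ i (by simp), Finset.disjoint_right.1 h.disjoint i.2]
  have h₃ : ∀ i : Z, π i = ω i := by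
    rintro ⟨i, hi⟩
    have hi' := hi
    rw [h.eq] at hi'
    simp only [Finset.mem_union, Finset.mem_erase] at hi'
    obtain hi' | hi' := hi'
    · exact (h₁ ⟨i, hi'.2⟩).trans (hσ ⟨i, hi'.2⟩ ⟨i, hi⟩ rfl)
    · exact (h₂ ⟨i, hi'.2⟩).trans (hτ ⟨i, hi'.2⟩ ⟨i, hi⟩ rfl)
  rw [map_cls σ h₁, map_cls τ h₂, comp_cls h E F hd, map_cls ω h₃,
    comp_cls h' _ _ (disjoint_inputs_relabel hd _ _)]
  exact congrArg _ (E.relabel_glue h h' F hd ((h₁ ⟨a, h.mem_left⟩).trans ha)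
    ((h₂ ⟨b, h.mem_right⟩).trans hb) _ _ _).symm

theorem MoveClass.comp_assoc {α : Type u} [DecidableEq α] [Infinite α]
    {C : CyclicOperad.{u, v} α} {a b c d : α} {X Y Z XY YZ W : Finset α}
    (h₁ : IsGluing a b X Y XY) (h₂ : IsGluing c d XY Z W)
    (h₃ : IsGluing c d Y Z YZ) (h₄ : IsGluing a b X YZ W)
    (x : MoveClass C X) (y : MoveClass C Y) (z : MoveClass C Z) :
    comp h₂ (comp h₁ x y) z = comp h₄ x (comp h₃ y z) := by
  obtain ⟨E, rfl, hE⟩ := x.exists_rep (Y ∪ Z)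
  obtain ⟨F, rfl, hF⟩ := y.exists_rep (E.inputs ∪ Z)
  obtain ⟨G, rfl, hG⟩ := z.exists_rep (E.inputs ∪ F.inputs)
  simp only [Finset.mem_union, not_or] at hE hF hG
  have g₁ := isGluing_iff.1 h₁
  have g₂ := isGluing_iff.1 h₂
  have g₃ := isGluing_iff.1 h₃
  have g₄ := isGluing_iff.1 h₄
  have hEF : Disjoint E.inputs F.inputs := Finset.disjoint_left.2 (by grind)
  have hFG : Disjoint F.inputs G.inputs := Finset.disjoint_left.2 (by grind)
  have hd : Disjoint (E.glue h₁ F hEF).inputs G.inputs := Finset.disjoint_left.2 (by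
    simp only [Expr.glue, Finset.mem_union, Finset.mem_erase]
    grind)
  have hd' : Disjoint E.inputs (F.glue h₃ G hFG).inputs := Finset.disjoint_left.2 (by
    simp only [Expr.glue, Finset.mem_union, Finset.mem_erase]
    grind)
  rw [comp_cls h₁ E F hEF, comp_cls h₃ F G hFG, comp_cls h₂ _ _ hd, comp_cls h₄ _ _ hd']
  exact Expr.cls_glue_assoc h₁ h₂ h₃ h₄ E F G hEF hFG hd hd'

theorem sym2_map_eq {α : Type u} {e e' : Sym2 α} (he : ¬ e.IsDiag) {f : α → α}
    (hf : f.Injective) (h : ∀ x ∈ e, f x ∈ e') : e.map f = e' := by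
  induction e with
  | _ x y =>
    have hxy : f x ≠ f y := fun h => he (by simpa using hf h)
    exact ((Sym2.mem_and_mem_iff hxy).1 ⟨h x (by simp), h y (by simp)⟩).symm

theorem MoveClass.contr_map {α : Type u} [DecidableEq α] [Infinite α]
    {C : CyclicOperad.{u, v} α} {e e' : Sym2 α} {X Z X' Z' : Finset α}
    (h : IsContraction e X Z) (h' : IsContraction e' X' Z') (σ : X ≃ X') (τ : Z ≃ Z')
    (he : ∀ i : X, (i : α) ∈ e → (σ i : α) ∈ e') (hστ : Agree σ τ) (x : MoveClass C X) :
    contr h' (map σ x) = map τ (contr h x) := by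
  obtain ⟨E, rfl⟩ := Quot.exists_rep x
  change contr h' (map σ E.cls) = map τ (E.contr h).cls
  obtain ⟨π, hπ⟩ := exists_perm_extend σ
  have hX := isContraction_iff.1 h
  have hτ : ∀ i : Z, π i = τ i := fun i =>
    (hπ ⟨i, (hX.2.2 _).2 (.inr i.2)⟩).trans (hστ _ i rfl)
  rw [map_cls σ hπ, map_cls τ hτ]
  refine congrArg _ (E.relabel_contr h h' (sym2_map_eq hX.1 π.injective fun x hx => ?_) _ _).symm
  have hxX := (hX.2.2 x).2 (.inl hx)
  rw [hπ ⟨x, hxX⟩]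
  exact he _ hx

theorem MoveClass.contr_contr {α : Type u} [DecidableEq α] {C : CyclicOperad.{u, v} α}
    {e f : Sym2 α} {X Y Y' Z : Finset α} (h₁ : IsContraction e X Y) (h₂ : IsContraction f Y Z)
    (h₃ : IsContraction f X Y') (h₄ : IsContraction e Y' Z) (x : MoveClass C X) :
    contr h₂ (contr h₁ x) = contr h₄ (contr h₃ x) := by
  obtain ⟨E, rfl⟩ := Quot.exists_rep x
  exact Expr.cls_eq_of_perm _ (List.Perm.swap e f _) _ _

theorem MoveClass.contr_comp_exchange {α : Type u} [DecidableEq α] [Infinite α]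
    {C : CyclicOperad.{u, v} α} {a b c d : α} {X Y Z Z' W : Finset α}
    (h₁ : IsGluing a b X Y Z) (k₁ : IsContraction s(c, d) Z W)
    (h₂ : IsGluing c d X Y Z') (k₂ : IsContraction s(a, b) Z' W)
    (x : MoveClass C X) (y : MoveClass C Y) :
    contr k₁ (comp h₁ x y) = contr k₂ (comp h₂ x y) := by
  obtain ⟨E, F, rfl, rfl, hd⟩ := exists_disjoint_reps h₁.disjoint x y
  rw [comp_cls h₁ E F hd, comp_cls h₂ E F hd, contr_cls, contr_cls]
  -- The new pair stands outermost; move (i) needs it innermost.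
  have hp : ∀ e : Sym2 α, (e :: (F.pairs ++ E.pairs)).Perm ((F.pairs ++ E.pairs) ++ [e]) :=
    fun e => (List.perm_append_singleton e _).symm
  refine (Expr.cls_eq_of_perm _ (hp _) _ (((E.glue h₁ F hd).contr k₁).contracts.perm (hp _))).trans
    (Eq.trans ?_ (Expr.cls_eq_of_perm _ (hp _) _
      (((E.glue h₂ F hd).contr k₂).contracts.perm (hp _))).symm)
  exact Quot.sound (.exchange _ _ _ _ _ _ _)

/-- On representatives both sides have the same element and the same pairs; only the position of `e`
differs. -/
theorem MoveClass.contr_comp {α : Type u} [DecidableEq α] [Infinite α]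
    {C : CyclicOperad.{u, v} α} {a b : α} {e : Sym2 α} {X X' Y Z W : Finset α}
    (h₁ : IsGluing a b X Y Z) (k₁ : IsContraction e Z W)
    (k₂ : IsContraction e X X') (h₂ : IsGluing a b X' Y W)
    (x : MoveClass C X) (y : MoveClass C Y) :
    contr k₁ (comp h₁ x y) = comp h₂ (contr k₂ x) y := by
  obtain ⟨E, F, rfl, rfl, hd⟩ := exists_disjoint_reps h₁.disjoint x y
  rw [comp_cls h₁ E F hd, contr_cls, contr_cls, comp_cls h₂ (E.contr k₂) F hd]
  exact Expr.cls_eq_of_perm _ List.perm_middle.symm _ _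

/-- The modular operad of classes of expressions. -/
noncomputable def moveOperad {α : Type u} [DecidableEq α] [Infinite α] (C : CyclicOperad.{u, v} α)
    (𝕊 : Type s) [AddCommMonoidWithOne 𝕊] : ModularOperad.{u, max u v} α 𝕊 where
  obj := MoveClass C
  map := MoveClass.map
  comp := MoveClass.comp
  genus := Quot.lift (fun E => (E.pairs.length : 𝕊)) fun _ _ h => congrArg _ h.length_eq
  contr := MoveClass.contr
  map_refl x := by
    obtain ⟨E, rfl⟩ := Quot.exists_rep x
    refine (MoveClass.map_cls _ (π := 1) (fun i => rfl) E).trans ?_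
    rw [E.relabel_eq_self _ fun _ _ => rfl]
    rfl
  map_trans σ τ x := by
    obtain ⟨E, rfl⟩ := Quot.exists_rep x
    obtain ⟨π, hπ⟩ := exists_perm_extend σ
    obtain ⟨ρ, hρ⟩ := exists_perm_extend τ
    change MoveClass.map _ E.cls = MoveClass.map τ (MoveClass.map σ E.cls)
    rw [MoveClass.map_cls σ hπ, MoveClass.map_cls τ hρ, Expr.relabel_relabel,
      MoveClass.map_cls (σ.trans τ) (π := ρ * π)]
    intro i
    rw [Equiv.Perm.mul_apply, hπ, hρ]
    rfl
  comp_map := MoveClass.comp_map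
  comp_comm h h' x y := by
    obtain ⟨E, F, rfl, rfl, hd⟩ := MoveClass.exists_disjoint_reps h.disjoint x y
    rw [MoveClass.comp_cls h E F hd, MoveClass.comp_cls h' F E hd.symm]
    exact E.cls_glue_comm h h' F hd
  comp_assoc := MoveClass.comp_assoc
  genus_map σ x := by
    obtain ⟨E, rfl⟩ := Quot.exists_rep x
    exact congrArg _ (List.length_map _)
  genus_comp h x y := by
    obtain ⟨E, F, rfl, rfl, hd⟩ := MoveClass.exists_disjoint_reps h.disjoint x y
    rw [MoveClass.comp_cls h E F hd]
    simp [Expr.cls, Expr.glue, add_comm]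
  genus_contr h x := by
    obtain ⟨E, rfl⟩ := Quot.exists_rep x
    exact Nat.cast_succ _
  contr_map := MoveClass.contr_map
  contr_contr := MoveClass.contr_contr
  contr_comp_exchange := MoveClass.contr_comp_exchange
  contr_comp := MoveClass.contr_comp

end CyclicOperad

/-! ### Iterated contractions in a modular operad -/

theorem contracts_append {α : Type u} [DecidableEq α] {l l' : List (Sym2 α)} {X S : Finset α} :
    Contracts (l' ++ l) X S ↔ ∃ A, Contracts l X A ∧ Contracts l' A S := by
  induction l' generalizing S with
  | nil => simp [Contracts]
  | cons e l' ih =>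
    simp only [List.cons_append, Contracts, ih]
    tauto

namespace ModularOperad

theorem contr_iterContr_congr {α : Type u} [DecidableEq α] {𝕊 : Type s} [AddCommMonoidWithOne 𝕊]
    (M : ModularOperad.{u, v} α 𝕊) {X A B Z : Finset α} (y : M.obj X) {e : Sym2 α}
    {l : List (Sym2 α)} (hAB : A = B) (k : IsContraction e A Z) (k' : IsContraction e B Z)
    (h : Contracts l X A) (h' : Contracts l X B) :
    M.contr k (M.iterContr y l h) = M.contr k' (M.iterContr y l h') := by
  subst hAB
  rfl

/-- Adjacent transpositions suffice, and these are the commutation axiom for contractions. -/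
theorem iterContr_perm {α : Type u} [DecidableEq α] {𝕊 : Type s} [AddCommMonoidWithOne 𝕊]
    (M : ModularOperad.{u, v} α 𝕊) {X S : Finset α} (y : M.obj X) {l l' : List (Sym2 α)}
    (hl : l.Perm l') (h : Contracts l X S) (h' : Contracts l' X S) :
    M.iterContr y l h = M.iterContr y l' h' := by
  induction hl generalizing S with
  | nil => rfl
  | cons e _ ih => exact congrArg (M.contr h.1) (ih h.2 h'.2)
  | swap e f l =>
    have hA : e.toFinset ∪ (f.toFinset ∪ S) = f.toFinset ∪ (e.toFinset ∪ S) :=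
      Finset.union_left_comm _ _ _
    refine Eq.trans (congrArg (M.contr h.1) (M.contr_iterContr_congr y hA h.2.1 (hA ▸ h.2.1)
      h.2.2 h'.2.2)) ?_
    exact M.contr_contr _ _ _ _ _
  | trans h₁ h₂ ih₁ ih₂ => exact (ih₁ h (h.perm h₁)).trans (ih₂ (h.perm h₁) h')

theorem iterContr_append {α : Type u} [DecidableEq α] {𝕊 : Type s} [AddCommMonoidWithOne 𝕊]
    (M : ModularOperad.{u, v} α 𝕊) {X A S : Finset α} (y : M.obj X) {l l' : List (Sym2 α)}
    (h : Contracts (l' ++ l) X S) (h₁ : Contracts l X A) (h₂ : Contracts l' A S) :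
    M.iterContr y (l' ++ l) h = M.iterContr (M.iterContr y l h₁) l' h₂ := by
  induction l' generalizing S with
  | nil =>
    cases h₂
    rfl
  | cons e l' ih => exact congrArg (M.contr _) (ih h.2 h₂.2)

theorem iterContr_singleton {α : Type u} [DecidableEq α] {𝕊 : Type s} [AddCommMonoidWithOne 𝕊]
    (M : ModularOperad.{u, v} α 𝕊) {X S : Finset α} (y : M.obj X) {e : Sym2 α}
    (h : Contracts [e] X S) (k : IsContraction e X S) : M.iterContr y [e] h = M.contr k y := by
  obtain rfl := k.eq
  rfl

theorem map_iterContr {α : Type u} [DecidableEq α] {𝕊 : Type s} [AddCommMonoidWithOne 𝕊]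
    (M : ModularOperad.{u, v} α 𝕊) {X X' S S' : Finset α} (y : M.obj X) {l : List (Sym2 α)}
    {π : Equiv.Perm α} (h : Contracts l X S) (h' : Contracts (l.map (Sym2.map π)) X' S')
    (τ : X ≃ X') (hτ : ∀ i, (τ i : α) = π i) (σ : S ≃ S') (hσ : ∀ i, (σ i : α) = π i) :
    M.map σ (M.iterContr y l h) = M.iterContr (M.map τ y) (l.map (Sym2.map π)) h' := by
  induction l generalizing S S' with
  | nil =>
    cases h
    cases h'
    exact M.map_congr (fun i => (hσ i).trans (hτ i).symm) y
  | cons e l ih =>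
    have hS : ∀ x, x ∈ S ↔ π x ∈ S' := CyclicOperad.mem_iff_of_extend fun i => (hσ i).symm
    have hm : ∀ x, x ∈ e.toFinset ∪ S ↔ π x ∈ (e.map π).toFinset ∪ S' := by
      simp [← hS, Sym2.mem_map]
    refine Eq.trans (M.contr_map h.1 h'.1 (π.subtypeEquiv hm) σ (fun i hi => ?_)
      (fun i j hij => ?_) (M.iterContr y l h.2)).symm
      (congrArg (M.contr h'.1) (ih h.2 h'.2 (π.subtypeEquiv hm) fun _ => rfl))
    · exact Sym2.mem_map.2 ⟨i, hi, rfl⟩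
    · rw [hσ, ← hij]
      rfl

theorem comp_iterContr_left {α : Type u} [DecidableEq α] {𝕊 : Type s} [AddCommMonoidWithOne 𝕊]
    (M : ModularOperad.{u, v} α 𝕊) {a b : α} {X Y S R U : Finset α} (x : M.obj X) (y : M.obj Y)
    {l : List (Sym2 α)} (h : IsGluing a b S Y R) (h' : IsGluing a b X Y U)
    (hl : Contracts l X S) (hl' : Contracts l U R) :
    M.comp h (M.iterContr x l hl) y = M.iterContr (M.comp h' x y) l hl' := by
  induction l generalizing S R with
  | nil =>
    cases hl
    cases hl'
    rfl
  | cons e l ih =>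
    have hg : IsGluing a b (e.toFinset ∪ S) Y (e.toFinset ∪ R) := by
      have h₁ := isGluing_iff.1 h
      have h₂ := isGluing_iff.1 h'
      have h₃ := (isContraction_iff.1 hl.1).2.1
      have h₄ := hl.2.subset
      have h₅ := (isContraction_iff.1 hl'.1).2.1
      have h₆ := hl'.2.subset
      simp only [isGluing_iff, Finset.mem_union, Sym2.mem_toFinset, Finset.subset_iff] at *
      grind
    exact (M.contr_comp hg hl'.1 hl.1 h _ _).symm.trans
      (congrArg (M.contr hl'.1) (ih hg hl.2 hl'.2))

/-- The contractions of the left factor are pulled out first and end up innermost; those of the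
right factor follow by symmetry. This explains the order `l' ++ l`. -/
theorem comp_iterContr {α : Type u} [DecidableEq α] {𝕊 : Type s} [AddCommMonoidWithOne 𝕊]
    (M : ModularOperad.{u, v} α 𝕊) {a b : α} {X Y S T R U : Finset α} (x : M.obj X)
    (y : M.obj Y) {l l' : List (Sym2 α)} (h : IsGluing a b S T R) (h' : IsGluing a b X Y U)
    (hl : Contracts l X S) (hl' : Contracts l' Y T) (hU : Contracts (l' ++ l) U R) :
    M.comp h (M.iterContr x l hl) (M.iterContr y l' hl') =
      M.iterContr (M.comp h' x y) (l' ++ l) hU := by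
  have hg : IsGluing a b S Y (S.erase a ∪ Y.erase b) :=
    ⟨h.mem_left, h'.mem_right, h'.disjoint.mono_left hl.subset, rfl⟩
  have h₁ : Contracts l U (S.erase a ∪ Y.erase b) :=
    hl.glue (l' := []) (T := Y) rfl hg h'
  have h₂ : Contracts l' (S.erase a ∪ Y.erase b) R := by
    simpa using (Contracts.glue (l' := []) hl' rfl h.symm hg.symm)
  rw [M.iterContr_append _ hU h₁ h₂, ← M.comp_iterContr_left x y hg h' hl h₁,
    M.comp_comm hg hg.symm, M.comp_comm h h.symm]
  exact M.comp_iterContr_left y _ h.symm hg.symm hl' h₂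

theorem Hom.app_iterContr {α : Type u} [DecidableEq α] {𝕊 : Type s} [AddCommMonoidWithOne 𝕊]
    {M : ModularOperad.{u, v} α 𝕊} {N : ModularOperad.{u, w} α 𝕊} (ψ : Hom M N)
    {X S : Finset α} (y : M.obj X) {l : List (Sym2 α)} (h : Contracts l X S) :
    ψ.app (M.iterContr y l h) = N.iterContr (ψ.app y) l h := by
  induction l generalizing S with
  | nil =>
    cases h
    rfl
  | cons e l ih => exact (ψ.app_contr h.1 _).trans (congrArg _ (ih h.2))

end ModularOperad

namespace CyclicOperad

/-! ### The values of expressions in the modular completion -/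

theorem Expr.value_relabel {α : Type u} [DecidableEq α] {C : CyclicOperad.{u, v} α}
    (𝕊 : Type s) [AddCommMonoidWithOne 𝕊] {S T : Finset α} (E : Expr C S) {π : Equiv.Perm α}
    (h : ∀ x, x ∈ S ↔ π x ∈ T) (σ : S ≃ T) (hσ : ∀ i, (σ i : α) = π i) :
    (E.relabel π h).value 𝕊 = (C.Mod 𝕊).map σ (E.value 𝕊) := by
  have hX : ∀ x, x ∈ E.inputs ↔ π x ∈ (E.relabel π h).inputs := by simp [mem_inputs_relabel]
  refine Eq.trans ?_ ((C.Mod 𝕊).map_iterContr ((C.toMod 𝕊).app E.elt).1 E.contracts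
    (E.relabel π h).contracts (π.subtypeEquiv hX) (fun _ => rfl) σ hσ).symm
  exact congrArg (fun z => (C.Mod 𝕊).iterContr z _ (E.relabel π h).contracts)
    (congrArg Subtype.val ((C.toMod 𝕊).app_map (π.subtypeEquiv hX) E.elt))

theorem Expr.IsRenaming.value_eq {α : Type u} [DecidableEq α] {C : CyclicOperad.{u, v} α}
    (𝕊 : Type s) [AddCommMonoidWithOne 𝕊] {S : Finset α} {E F : Expr C S}
    (h : IsRenaming E F) : F.value 𝕊 = E.value 𝕊 := by
  obtain ⟨π, hπ, rfl⟩ := h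
  rw [E.value_relabel 𝕊 _ (Equiv.refl S) fun i => (hπ i i.2).symm, (C.Mod 𝕊).map_refl]

theorem Expr.value_contr {α : Type u} [DecidableEq α] {C : CyclicOperad.{u, v} α}
    (𝕊 : Type s) [AddCommMonoidWithOne 𝕊] {e : Sym2 α} {S Z : Finset α}
    (h : IsContraction e S Z) (E : Expr C S) :
    (E.contr h).value 𝕊 = (C.Mod 𝕊).contr h (E.value 𝕊) := by
  obtain rfl := h.eq
  rfl

theorem Expr.value_glue {α : Type u} [DecidableEq α] {C : CyclicOperad.{u, v} α}
    (𝕊 : Type s) [AddCommMonoidWithOne 𝕊] {a b : α} {S T R : Finset α} (h : IsGluing a b S T R)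
    (E : Expr C S) (F : Expr C T) (hd : Disjoint E.inputs F.inputs) :
    (E.glue h F hd).value 𝕊 = (C.Mod 𝕊).comp h (E.value 𝕊) (F.value 𝕊) := by
  have hg := h.of_contracts E.contracts F.contracts hd
  refine Eq.trans ?_ ((C.Mod 𝕊).comp_iterContr ((C.toMod 𝕊).app E.elt).1
    ((C.toMod 𝕊).app F.elt).1 h hg E.contracts F.contracts (E.glue h F hd).contracts).symm
  exact congrArg (fun z => (C.Mod 𝕊).iterContr z _ (E.glue h F hd).contracts)
    (congrArg Subtype.val ((C.toMod 𝕊).app_comp hg E.elt F.elt))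

theorem Move.value_eq {α : Type u} [DecidableEq α] {C : CyclicOperad.{u, v} α}
    (𝕊 : Type s) [AddCommMonoidWithOne 𝕊] {S : Finset α} {E F : Expr C S} (h : Move E F) :
    E.value 𝕊 = F.value 𝕊 := by
  cases h with
  | @exchange p' q' p'' q'' X Y U V w' w'' l hq hp hU hV =>
    -- The innermost contraction is split off. The remaining list `l` determines the intermediate
    -- set, which is therefore the same for both expressions.
    obtain ⟨A, hA, hA'⟩ := contracts_append.1 hU
    obtain ⟨B, hB, hB'⟩ := contracts_append.1 hV
    have hAB : A = B := hA'.eq hB'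
    subst hAB
    have kA : IsContraction s(p', p'') U A := by
      obtain rfl : U = _ := hA.2
      exact hA.1
    have kB : IsContraction s(q', q'') V A := by
      obtain rfl : V = _ := hB.2
      exact hB.1
    simp only [Expr.value]
    rw [(C.Mod 𝕊).iterContr_append _ hU hA hA', (C.Mod 𝕊).iterContr_append _ hV hB hB',
      (C.Mod 𝕊).iterContr_singleton _ hA kA, (C.Mod 𝕊).iterContr_singleton _ hB kB,
      (C.toMod 𝕊).app_comp, (C.toMod 𝕊).app_comp]
    exact congrArg (fun z => (C.Mod 𝕊).iterContr z l hA')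
      ((C.Mod 𝕊).contr_comp_exchange hq kA hp kB
        ((C.toMod 𝕊).app w').1 ((C.toMod 𝕊).app w'').1)
  | relabel y l ρ hp' hp'' hρ hX hX' =>
    exact ((Expr.isRenaming_map y l ρ hp' hp'' hρ hX hX').value_eq 𝕊).symm
  | permute y hl h h' => exact (C.Mod 𝕊).iterContr_perm _ hl h h'

theorem exists_expr_value_eq {α : Type u} [DecidableEq α] [Infinite α]
    {C : CyclicOperad.{u, v} α} (𝕊 : Type s) [AddCommMonoidWithOne 𝕊] {S : Finset α}
    (x : (C.Mod 𝕊).obj S) : ∃ E : Expr C S, x = E.value 𝕊 := by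
  obtain ⟨t, rfl⟩ := Quotient.exists_rep x
  induction t with
  | gen x => exact ⟨⟨_, x, [], rfl⟩, rfl⟩
  | map σ t ih =>
    obtain ⟨E, hE⟩ := ih
    obtain ⟨π, hπ⟩ := exists_perm_extend σ
    refine ⟨E.relabel π (mem_iff_of_extend hπ), ?_⟩
    rw [E.value_relabel 𝕊 _ σ fun i => (hπ i).symm, ← hE]
    rfl
  | comp h t t' ih ih' =>
    obtain ⟨E, hE⟩ := ih
    obtain ⟨F, hF⟩ := ih'
    obtain ⟨E', F', hE', hF', hd⟩ := Expr.exists_isRenaming_disjoint h.disjoint E F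
    refine ⟨E'.glue h F' hd, ?_⟩
    rw [Expr.value_glue 𝕊, hE'.value_eq 𝕊, hF'.value_eq 𝕊, ← hE, ← hF]
    rfl
  | contr h t ih =>
    obtain ⟨E, hE⟩ := ih
    refine ⟨E.contr h, ?_⟩
    rw [Expr.value_contr, ← hE]
    rfl

/-- The morphism from a cyclic operad to the classes of expressions. -/
noncomputable def toMoveOperad {α : Type u} [DecidableEq α] [Infinite α]
    (C : CyclicOperad.{u, v} α) (𝕊 : Type s) [AddCommMonoidWithOne 𝕊] :
    CyclicOperad.Hom C (C.moveOperad 𝕊).genusZero where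
  app x := ⟨Expr.cls ⟨_, x, [], rfl⟩, Nat.cast_zero⟩
  app_map σ x := by
    obtain ⟨π, hπ⟩ := exists_perm_extend σ
    refine Subtype.ext (Eq.trans (congrArg Expr.cls ?_) (MoveClass.map_cls σ hπ _).symm)
    refine Expr.mk_eq_mk (Equiv.subtypeEquivRight fun i => ?_) (fun _ => rfl) ?_ rfl
    · refine Iff.trans ?_ (Expr.mem_inputs_relabel _ π (mem_iff_of_extend hπ) i).symm
      simpa using (mem_iff_of_extend hπ (π.symm i)).symm
    · rw [← C.map_trans]
      exact C.map_congr (fun i => (hπ i).symm) _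
  app_comp h x y := by
    refine Subtype.ext (Eq.trans (congrArg Expr.cls ?_)
      (MoveClass.comp_cls h ⟨_, x, [], rfl⟩ ⟨_, y, [], rfl⟩ h.disjoint).symm)
    exact Expr.mk_eq_mk (Equiv.subtypeEquivRight fun i => by rw [h.eq]) (fun _ => rfl)
      (C.map_comp _ _ _ (fun _ => rfl) _ _) rfl

/-! ### Recovering the class from the value. -/

theorem moveOperad_iterContr {α : Type u} [DecidableEq α] [Infinite α]
    {C : CyclicOperad.{u, v} α} (𝕊 : Type s) [AddCommMonoidWithOne 𝕊] {X S : Finset α}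
    (y : C.obj X) {l : List (Sym2 α)} (h : Contracts l X S) :
    (C.moveOperad 𝕊).iterContr (Expr.cls ⟨X, y, [], rfl⟩) l h = Expr.cls ⟨X, y, l, h⟩ := by
  induction l generalizing S with
  | nil =>
    cases h
    rfl
  | cons e l ih => exact congrArg (MoveClass.contr h.1) (ih h.2)

/-- A morphism of modular operads commutes with iterated contractions, and in `moveOperad`
contracting the class of a bare element just lists the pairs. Hence the value determines the class.
-/
theorem liftMod_value {α : Type u} [DecidableEq α] [Infinite α] {C : CyclicOperad.{u, v} α}
    (𝕊 : Type s) [AddCommMonoidWithOne 𝕊] {S : Finset α} (E : Expr C S) :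
    (liftMod (C.toMoveOperad 𝕊)).app (E.value 𝕊) = E.cls :=
  (ModularOperad.Hom.app_iterContr _ _ _).trans (moveOperad_iterContr 𝕊 E.elt E.contracts)

end CyclicOperad

theorem mainTheorem4 {α : Type u} [DecidableEq α] [Infinite α] {𝕊 : Type s}
    [AddCommMonoidWithOne 𝕊] (C : CyclicOperad.{u, v} α) (S : Finset α) :
    (∀ x : (C.Mod 𝕊).obj S, ∃ E : CyclicOperad.Expr C S, x = E.value 𝕊) ∧
    (∀ E E' : CyclicOperad.Expr C S,
      E.value 𝕊 = E'.value 𝕊 ↔ Relation.ReflTransGen CyclicOperad.Move E E') := by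
  refine ⟨CyclicOperad.exists_expr_value_eq 𝕊, fun E E' => ⟨fun h => ?_, fun h => ?_⟩⟩
  · rw [← CyclicOperad.Expr.cls_eq_cls, ← CyclicOperad.liftMod_value 𝕊, h,
      CyclicOperad.liftMod_value]
  · induction h with
    | refl => rfl
    | tail _ h ih => exact ih.trans (h.value_eq 𝕊)
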